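/- **Setting.** Let $\mathcal V$ be a monoidal model category whose unit object $I$ is cofibrant: $\mathcal V$ is a complete and cocomplete symmetric monoidal closed category, with internal hom $[-,-]$, equipped with a model structure such that for cofibrations $f,g$ the pushout-product $f\mathbin{\square} g$ is a cofibration, which is moreover a weak equivalence if $f$ or $g$ is one. (Since $I$ is cofibrant, the usual unit axiom holds automatically.) Assume that the category $\mathcal V$ is locally presentable. For a $\mathcal V$-category $\mathcal C$ write $\mathcal C_0$ for its underlying ordinary category; for a small $\mathcal V$-category $\mathcal D$ and $\mathcal V$-functors $F,G\colon\mathcal D\to\mathcal V$ write $[\mathcal D,\mathcal V](F,G)=\int_{X}[FX,GX]$ for the object of $\mathcal V$-natural transformations. **Shrinkable morphisms.** An *interval* is an object $J$ of $\mathcal V$ with a factorisation $I+I\xrightarrow{(d\ c)}J\xrightarrow{e}I$ of the codiagonal in which $(d\ c)$ is a cofibration and $e$ is a weak equivalence. A morphism $f\colon A\to B$ of $\mathcal V$ is *shrinkable* if there are a morphism $s\colon B\to A$ with $fs=1_B$, an interval $(J,d,c,e)$ and a morphism $h\colon J\to[A,A]$ such that $hd$ and $hc$ are the names $I\to [A,A]$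 of $sf$ and of $1_A$, and such that $[A,f]\circ h$ factorises through $e$. Let $\mathcal E$ be the class of shrinkable morphisms of $\mathcal V$. **$\mathcal E$-weak colimits.** $\mathcal C$ *admits all $\mathcal E$-weak colimits* if for every small $\mathcal V$-category $\mathcal D$ and all $\mathcal V$-functors $W\colon\mathcal D^{\mathrm{op}}\to\mathcal V$ and $S\colon\mathcal D\to\mathcal C$ there are an object $L$ of $\mathcal C$ and a $\mathcal V$-natural transformation $\eta\colon W\to\mathcal C(S-,L)$ such that for every object $A$ of $\mathcal C$ the induced morphism $\mathcal C(L,A)\to[\mathcal D^{\mathrm{op}},\mathcal V](W,\mathcal C(S-,A))$ lies in $\mathcal E$. **Powers and enough cofibrantly-weighted limits.** $\mathcal C$ has *powers* if for all $X\in\mathcal V$ and $B\in\mathcal C$ there are an object $P$ of $\mathcal C$ and a morphism $X\to\mathcal C(P,B)$ inducing isomorphisms $\mathcal C(A,P)\cong[X,\mathcal C(A,B)]$ for all $A$. For a small $\mathcal D$, a weight $Q\colon\mathcal D\to\mathcal V$ is *cofibrant* if $[\mathcal D,\mathcal V](Q,p)$ is a trivial fibration in $\mathcal V$ whenever $p$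 is a pointwise trivial fibration between $\mathcal V$-functors $\mathcal D\to\mathcal V$. Let $\mathcal I$ be the unit $\mathcal V$-category (one object, with endomorphism object $I$) and let $I\colon\mathcal I\to\mathcal V$ also denote the $\mathcal V$-functor selecting the object $I$. $\mathcal C$ has *enough cofibrantly-weighted limits* if for every small $\mathcal V$-category $\mathcal D$ and every $\mathcal V$-functor $P\colon\mathcal D\to\mathcal I$ there are a cofibrant weight $Q\colon\mathcal D\to\mathcal V$ and a pointwise trivial fibration $Q\to IP$ such that $\mathcal C$ has the $Q$-weighted limit of every $\mathcal V$-functor $\mathcal D\to\mathcal C$. **Accessibility.** A *conical colimit* in $\mathcal C$ is a colimit in $\mathcal C_0$ that each $\mathcal C(-,X)_0\colon\mathcal C_0^{\mathrm{op}}\to\mathcal V$ sends to a limit. For a regular cardinal $\lambda$, an object $A$ of $\mathcal C$ is *$\lambda$-presentable* if $\mathcal C(A,-)$ preserves conical $\lambda$-filtered colimits, and $\mathcal C$ is *$\lambda$-accessible* if it has all small conical $\lambda$-filtered colimits and there is a (small) set $\mathcal G$ of $\lambda$-presentable objects such that every object of $\mathcal C$ is a conical $\lambda$-filtered colimit of objects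 of $\mathcal G$. $\mathcal C$ is *accessible* if it is $\lambda$-accessible for some regular cardinal $\lambda$ for which there is a regular $\lambda_0\le\lambda$ such that $\mathcal V$ is locally $\lambda_0$-presentable, $I$ is $\lambda_0$-presentable, and the $\lambda_0$-presentable objects of $\mathcal V$ are closed under $\otimes$. **Theorem.** Let $\mathcal C$ be an accessible $\mathcal V$-category with powers and enough cofibrantly-weighted limits. Then $\mathcal C$ admits all $\mathcal E$-weak colimits. -/

import Mathlib

open CategoryTheory MonoidalCategory Limits HomotopicalAlgebra Opposite
open scoped CategoryTheory.MonoidalClosed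

universe v u w u'

set_option linter.unusedSectionVars false

namespace EWeak
noncomputable section

variable {V : Type u} [Category.{v} V] [MonoidalCategory V] [SymmetricCategory V] [MonoidalClosed V]

section Weights
variable {D : Type w} [EnrichedCategory V D]

/-- A `V`-natural transformation `F ⟶ G` between `V`-functors `F G : D → V`: a family
`p_X : F X ⟶ G X` such that the two maps `D(X,Y) ⟶ [F X, G Y]`, namely `F_{XY}` followed by
`[F X, p_Y]` and `G_{XY}` followed by `[p_X, G Y]`, agree. -/
structure WeightHom (F G : EnrichedFunctor V D V) where
  app (X : D) : F.obj X ⟶ G.obj X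
  naturality (X Y : D) :
    F.map X Y ≫ (ihom (F.obj X)).map (app Y) =
      G.map X Y ≫ (MonoidalClosed.pre (app X)).app (G.obj Y)

/-- The transpose `F X ⊗ D(X,Y) ⟶ F Y` of the action of a `V`-functor `F : D → V` on homs. -/
def act (F : EnrichedFunctor V D V) (X Y : D) : F.obj X ⊗ EnrichedCategory.Hom X Y ⟶ F.obj Y :=
  MonoidalClosed.uncurry (F.map X Y)

lemma WeightHom.act_comp {F G : EnrichedFunctor V D V} (p : WeightHom F G) (X Y : D) :
    act F X Y ≫ p.app Y = p.app X ▷ _ ≫ act G X Y := by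
  have h := congrArg MonoidalClosed.uncurry (p.naturality X Y)
  rw [MonoidalClosed.uncurry_pre_app] at h
  exact (MonoidalClosed.uncurry_natural_right _ _).symm.trans h

/-- The map `[F X, G X] ⟶ [D(X,Y), [F X, G Y]]` given by the action of `G` on homs. -/
def wedgeLeft (F G : EnrichedFunctor V D V) (X Y : D) :
    (ihom (F.obj X)).obj (G.obj X) ⟶
      (ihom (EnrichedCategory.Hom X Y : V)).obj ((ihom (F.obj X)).obj (G.obj Y)) :=
  MonoidalClosed.curry ((β_ _ _).hom ≫ _ ◁ G.map X Y ≫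
    eComp V (F.obj X) (G.obj X) (G.obj Y))

/-- The map `[F Y, G Y] ⟶ [D(X,Y), [F X, G Y]]` given by the action of `F` on homs. -/
def wedgeRight (F G : EnrichedFunctor V D V) (X Y : D) :
    (ihom (F.obj Y)).obj (G.obj Y) ⟶
      (ihom (EnrichedCategory.Hom X Y : V)).obj ((ihom (F.obj X)).obj (G.obj Y)) :=
  MonoidalClosed.curry (F.map X Y ▷ _ ≫ eComp V (F.obj X) (F.obj Y) (G.obj Y))

lemma uncurry_eComp {A B C X Y : V} (f : X ⟶ (ihom A).obj B) (g : Y ⟶ (ihom B).obj C) :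
    MonoidalClosed.uncurry ((f ⊗ₘ g) ≫ eComp V A B C) =
      (α_ _ _ _).inv ≫ MonoidalClosed.uncurry f ▷ Y ≫ MonoidalClosed.uncurry g := by
  change MonoidalClosed.uncurry ((f ⊗ₘ g) ≫ MonoidalClosed.comp A B C) = _
  rw [MonoidalClosed.uncurry_natural_left, MonoidalClosed.comp_eq, MonoidalClosed.uncurry_curry,
    MonoidalClosed.compTranspose_eq]
  simp only [MonoidalClosed.uncurry_eq, MonoidalCategory.tensorHom_def,
    MonoidalCategory.whiskerLeft_comp, comp_whiskerRight, Category.assoc]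
  rw [associator_inv_naturality_right_assoc, whisker_exchange_assoc,
    associator_inv_naturality_middle_assoc]
  rfl

lemma wedge_iff (F G : EnrichedFunctor V D V) {A : V}
    (k : ∀ X, A ⟶ (ihom (F.obj X)).obj (G.obj X)) (X Y : D) :
    k X ≫ wedgeLeft F G X Y = k Y ≫ wedgeRight F G X Y ↔
      _ ◁ (β_ _ _).hom ≫ (α_ _ _ _).inv ≫ MonoidalClosed.uncurry (k X) ▷ _ ≫ act G X Y =
        (α_ _ _ _).inv ≫ act F X Y ▷ A ≫ MonoidalClosed.uncurry (k Y) := by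
  rw [wedgeLeft, wedgeRight, ← MonoidalClosed.curry_natural_left,
    ← MonoidalClosed.curry_natural_left, MonoidalClosed.curry_injective.eq_iff,
    ← MonoidalClosed.uncurry_injective.eq_iff]
  have e1 : (EnrichedCategory.Hom X Y : V) ◁ k X ≫ (β_ _ _).hom ≫ _ ◁ G.map X Y ≫
      eComp V (F.obj X) (G.obj X) (G.obj Y) =
      (β_ _ _).hom ≫ (k X ⊗ₘ G.map X Y) ≫ eComp V (F.obj X) (G.obj X) (G.obj Y) := by
    rw [BraidedCategory.braiding_naturality_right_assoc, MonoidalCategory.tensorHom_def, Category.assoc]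
  have e2 : (EnrichedCategory.Hom X Y : V) ◁ k Y ≫ F.map X Y ▷ _ ≫
      eComp V (F.obj X) (F.obj Y) (G.obj Y) =
      (F.map X Y ⊗ₘ k Y) ≫ eComp V (F.obj X) (F.obj Y) (G.obj Y) := by
    rw [MonoidalCategory.tensorHom_def', Category.assoc]
  rw [e1, e2, MonoidalClosed.uncurry_natural_left]
  erw [uncurry_eComp, uncurry_eComp]
  rfl

end Weights

section NatObj
variable [HasLimits V] {D : Type v} [EnrichedCategory V D]

/-- The object `[D,V](F,G)` of `V`-natural transformations, for a small `V`-category `D`: the end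
`∫_X [F X, G X]`, built as the equalizer of the two maps
`∏_X [F X, G X] ⇉ ∏_{X,Y} [D(X,Y), [F X, G Y]]`. -/
def natObj (F G : EnrichedFunctor V D V) : V :=
  equalizer
    (Pi.lift fun p : D × D =>
      Pi.π (fun X : D => (ihom (F.obj X)).obj (G.obj X)) p.1 ≫ wedgeLeft F G p.1 p.2)
    (Pi.lift fun p : D × D =>
      Pi.π (fun X : D => (ihom (F.obj X)).obj (G.obj X)) p.2 ≫ wedgeRight F G p.1 p.2)

/-- The projection `[D,V](F,G) ⟶ [F X, G X]`. -/
def natObjπ (F G : EnrichedFunctor V D V) (X : D) :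
    natObj F G ⟶ (ihom (F.obj X)).obj (G.obj X) :=
  equalizer.ι _ _ ≫ Pi.π _ X

lemma natObjπ_wedge (F G : EnrichedFunctor V D V) (X Y : D) :
    natObjπ F G X ≫ wedgeLeft F G X Y = natObjπ F G Y ≫ wedgeRight F G X Y := by
  have h := equalizer.condition
    (Pi.lift fun p : D × D =>
      Pi.π (fun X : D => (ihom (F.obj X)).obj (G.obj X)) p.1 ≫ wedgeLeft F G p.1 p.2)
    (Pi.lift fun p : D × D =>
      Pi.π (fun X : D => (ihom (F.obj X)).obj (G.obj X)) p.2 ≫ wedgeRight F G p.1 p.2)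
  have h' := congrArg (fun t => t ≫ Pi.π _ (X, Y)) h
  simp only [Category.assoc, Pi.lift_π] at h'
  exact (Category.assoc _ _ _).trans (h'.trans (Category.assoc _ _ _).symm)

/-- The universal property of `[D,V](F,G)` as an end. -/
def natObjLift (F G : EnrichedFunctor V D V) {A : V}
    (k : ∀ X, A ⟶ (ihom (F.obj X)).obj (G.obj X))
    (hk : ∀ X Y, k X ≫ wedgeLeft F G X Y = k Y ≫ wedgeRight F G X Y) : A ⟶ natObj F G :=
  equalizer.lift (Pi.lift k) (by
    apply Pi.hom_ext
    rintro ⟨X, Y⟩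
    simpa using hk X Y)

@[simp]
lemma natObjLift_π (F G : EnrichedFunctor V D V) {A : V}
    (k : ∀ X, A ⟶ (ihom (F.obj X)).obj (G.obj X))
    (hk : ∀ X Y, k X ≫ wedgeLeft F G X Y = k Y ≫ wedgeRight F G X Y) (X : D) :
    natObjLift F G k hk ≫ natObjπ F G X = k X :=
  (equalizer.lift_ι_assoc _ _ _).trans (Pi.lift_π _ _)

/-- The map `[D,V](Q,p) : [D,V](Q,F) ⟶ [D,V](Q,G)` given by composition with `p : F ⟶ G`. -/
def natObjMap (Q : EnrichedFunctor V D V) {F G : EnrichedFunctor V D V} (p : WeightHom F G) :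
    natObj Q F ⟶ natObj Q G :=
  natObjLift Q G (fun X => natObjπ Q F X ≫ (ihom (Q.obj X)).map (p.app X)) (fun X Y => by
    have h := (wedge_iff Q F (natObjπ Q F) X Y).1 (natObjπ_wedge Q F X Y)
    refine (wedge_iff Q G (fun X => natObjπ Q F X ≫ (ihom (Q.obj X)).map (p.app X)) X Y).2 ?_
    rw [MonoidalClosed.uncurry_natural_right, MonoidalClosed.uncurry_natural_right,
      comp_whiskerRight_assoc, ← p.act_comp]
    have h' := congrArg (fun t => t ≫ p.app Y) h
    simpa using h')

end NatObj

section Representables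
variable {C : Type u'} [EnrichedCategory V C]

/-- The representable `V`-functor `C(B,-) : C → V`. -/
def coyo (B : C) : EnrichedFunctor V C V where
  obj X := EnrichedCategory.Hom B X
  map X Y := MonoidalClosed.curry (eComp V B X Y)
  map_id X := by
    rw [← MonoidalClosed.curry_natural_left]
    change _ = MonoidalClosed.id _
    rw [MonoidalClosed.id_eq]
    congr 1
    rw [← cancel_epi (ρ_ _).inv, e_comp_id, Iso.inv_hom_id]
  map_comp X Y Z := by
    apply MonoidalClosed.uncurry_injective
    erw [uncurry_eComp]
    rw [MonoidalClosed.uncurry_natural_left, MonoidalClosed.uncurry_curry,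
      MonoidalClosed.uncurry_curry, MonoidalClosed.uncurry_curry, e_assoc]

lemma act_coyo (B X Y : C) : act (coyo (V := V) B) X Y = eComp V B X Y :=
  MonoidalClosed.uncurry_curry _

/-- The representable `V`-functor `C(-,A) : Cᵒᵖ → V`. -/
def yo (A : C) : EnrichedFunctor V Cᵒᵖ V where
  obj X := EnrichedCategory.Hom X.unop A
  map X Y := MonoidalClosed.curry ((β_ _ _).hom ≫ eComp V Y.unop X.unop A)
  map_id X := (coyo (V := V) (op A)).map_id X
  map_comp X Y Z := (coyo (V := V) (op A)).map_comp X Y Z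

lemma act_yo (A : C) (X Y : Cᵒᵖ) :
    act (yo (V := V) A) X Y = (β_ _ _).hom ≫ eComp V Y.unop X.unop A :=
  MonoidalClosed.uncurry_curry _

/-- The opposite `Sᵒᵖ : Dᵒᵖ → Cᵒᵖ` of a `V`-functor `S`. -/
def opFunctor {D : Type w} [EnrichedCategory V D] (S : EnrichedFunctor V D C) :
    EnrichedFunctor V Dᵒᵖ Cᵒᵖ where
  obj X := op (S.obj X.unop)
  map X Y := S.map Y.unop X.unop
  map_id X := S.map_id X.unop
  map_comp X Y Z := by
    change ((β_ _ _).hom ≫ eComp V Z.unop Y.unop X.unop) ≫ S.map Z.unop X.unop =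
      (S.map Y.unop X.unop ⊗ₘ S.map Z.unop Y.unop) ≫ (β_ _ _).hom ≫
        eComp V (S.obj Z.unop) (S.obj Y.unop) (S.obj X.unop)
    rw [Category.assoc, S.map_comp, BraidedCategory.braiding_naturality_assoc]

lemma act_comp_functor {D : Type w} [EnrichedCategory V D] (S : EnrichedFunctor V D C)
    (F : EnrichedFunctor V C V) (X Y : D) :
    act (S.comp V F) X Y = _ ◁ S.map X Y ≫ act F (S.obj X) (S.obj Y) :=
  MonoidalClosed.uncurry_natural_left _ _

/-- The `V`-functor `C(B,S-) : D → V`. -/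
abbrev homFrom {D : Type w} [EnrichedCategory V D] (S : EnrichedFunctor V D C) (B : C) :
    EnrichedFunctor V D V :=
  S.comp V (coyo B)

/-- The `V`-functor `C(S-,A) : Dᵒᵖ → V`. -/
abbrev homTo {D : Type w} [EnrichedCategory V D] (S : EnrichedFunctor V D C) (A : C) :
    EnrichedFunctor V Dᵒᵖ V :=
  (opFunctor S).comp V (yo A)

/-- The map `C(A,P) ⟶ [X, C(A,B)]` induced by `κ : X ⟶ C(P,B)`. -/
def powerMap {X : V} {P B : C} (κ : X ⟶ EnrichedCategory.Hom P B) (A : C) :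
    (EnrichedCategory.Hom A P : V) ⟶ (ihom X).obj (EnrichedCategory.Hom A B) :=
  MonoidalClosed.curry (κ ▷ _ ≫ (β_ _ _).hom ≫ eComp V A P B)

lemma limit_aux {P E P' : V} {B L X Y : C} (a : P ⟶ EnrichedCategory.Hom L X)
    (s : E ⟶ EnrichedCategory.Hom X Y) (b : P' ⟶ EnrichedCategory.Hom L Y) (r : P ⊗ E ⟶ P')
    (h : r ≫ b = a ▷ E ≫ _ ◁ s ≫ eComp V L X Y) :
    P ◁ (β_ E (EnrichedCategory.Hom B L)).hom ≫ (α_ _ _ _).inv ≫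
      (a ▷ _ ≫ (β_ _ _).hom ≫ eComp V B L X) ▷ E ≫ _ ◁ s ≫ eComp V B X Y =
    (α_ _ _ _).inv ≫ r ▷ _ ≫ b ▷ _ ≫ (β_ _ _).hom ≫ eComp V B L Y := by
  rw [← comp_whiskerRight_assoc, h]
  simp only [comp_whiskerRight, Category.assoc]
  rw [BraidedCategory.braiding_naturality_left_assoc, ← e_assoc, ← whisker_exchange_assoc,
    ← whisker_exchange_assoc, BraidedCategory.braiding_naturality_left_assoc,
    BraidedCategory.braiding_naturality_left_assoc, associator_inv_naturality_right_assoc,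
    associator_inv_naturality_middle_assoc, ← whisker_exchange_assoc,
    ← comp_whiskerRight_assoc _ (β_ _ _).hom, BraidedCategory.braiding_naturality_left,
    comp_whiskerRight_assoc, BraidedCategory.hexagon_reverse_assoc, whisker_exchange_assoc,
    whisker_exchange_assoc]

lemma colimit_aux {P E P' : V} {A L X Y : C} (a : P ⟶ EnrichedCategory.Hom X L)
    (s : E ⟶ EnrichedCategory.Hom Y X) (b : P' ⟶ EnrichedCategory.Hom Y L) (r : P ⊗ E ⟶ P')
    (h : r ≫ b = a ▷ E ≫ _ ◁ s ≫ (β_ _ _).hom ≫ eComp V Y X L) :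
    P ◁ (β_ E (EnrichedCategory.Hom L A)).hom ≫ (α_ _ _ _).inv ≫
      (a ▷ _ ≫ eComp V X L A) ▷ E ≫ _ ◁ s ≫ (β_ _ _).hom ≫ eComp V Y X A =
    (α_ _ _ _).inv ≫ r ▷ _ ≫ b ▷ _ ≫ eComp V Y L A := by
  have e : a ▷ E ≫ _ ◁ s ≫ (β_ _ _).hom = (β_ _ _).hom ≫ s ▷ P ≫ _ ◁ a := by
    rw [BraidedCategory.braiding_naturality_right, BraidedCategory.braiding_naturality_left_assoc,
      whisker_exchange]
  rw [← comp_whiskerRight_assoc, h, reassoc_of% e]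
  simp only [comp_whiskerRight, Category.assoc]
  rw [← whisker_exchange_assoc, ← whisker_exchange_assoc,
    BraidedCategory.braiding_naturality_left_assoc, BraidedCategory.braiding_naturality_left_assoc,
    BraidedCategory.braiding_naturality_right_assoc, ← e_assoc,
    associator_inv_naturality_middle_assoc, associator_inv_naturality_left_assoc,
    BraidedCategory.hexagon_reverse_assoc, ← MonoidalCategory.whiskerLeft_comp_assoc,
    SymmetricCategory.symmetry, MonoidalCategory.whiskerLeft_id, Category.id_comp]

variable [HasLimits V] {D : Type v} [EnrichedCategory V D]

/-- The map `C(B,L) ⟶ [D,V](Q, C(B,S-))` induced by a `V`-natural `η : Q ⟶ C(L,S-)`. -/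
def limitMap {Q : EnrichedFunctor V D V} {S : EnrichedFunctor V D C} {L : C}
    (η : WeightHom Q (homFrom S L)) (B : C) :
    (EnrichedCategory.Hom B L : V) ⟶ natObj Q (homFrom S B) :=
  natObjLift Q (homFrom S B)
    (fun X => MonoidalClosed.curry (η.app X ▷ _ ≫ (β_ _ _).hom ≫ eComp V B L (S.obj X)))
    (fun X Y => by
      refine (wedge_iff Q (homFrom S B) (fun X => MonoidalClosed.curry
        (η.app X ▷ _ ≫ (β_ _ _).hom ≫ eComp V B L (S.obj X))) X Y).2 ?_
      have h := η.act_comp X Y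
      rw [act_comp_functor, act_coyo] at h
      rw [act_comp_functor, act_coyo, MonoidalClosed.uncurry_curry, MonoidalClosed.uncurry_curry]
      exact limit_aux (η.app X) (S.map X Y) (η.app Y) (act Q X Y) h)

/-- The map `C(L,A) ⟶ [Dᵒᵖ,V](W, C(S-,A))` induced by a `V`-natural `η : W ⟶ C(S-,L)`. -/
def colimitMap {W : EnrichedFunctor V Dᵒᵖ V} {S : EnrichedFunctor V D C} {L : C}
    (η : WeightHom W (homTo S L)) (A : C) :
    (EnrichedCategory.Hom L A : V) ⟶ natObj W (homTo S A) :=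
  natObjLift W (homTo S A)
    (fun X => MonoidalClosed.curry (η.app X ▷ _ ≫ eComp V (S.obj X.unop) L A))
    (fun X Y => by
      refine (wedge_iff W (homTo S A) (fun X => MonoidalClosed.curry
        (η.app X ▷ _ ≫ eComp V (S.obj X.unop) L A)) X Y).2 ?_
      have h := η.act_comp X Y
      rw [act_comp_functor, act_yo] at h
      rw [act_comp_functor, act_yo, MonoidalClosed.uncurry_curry, MonoidalClosed.uncurry_curry]
      exact colimit_aux (η.app X) (S.map Y.unop X.unop) (η.app Y) (act W X Y) h)

end Representables

section UnitCat
variable (V)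

/-- The type of objects of the unit `V`-category: one object, with hom-object the unit `𝟙_ V`. -/
def UnitCat (_ : Type u) : Type := Unit

instance : EnrichedCategory V (UnitCat V) where
  Hom _ _ := 𝟙_ V
  id _ := 𝟙 _
  comp _ _ _ := (λ_ _).hom
  id_comp _ _ := by simp
  comp_id _ _ := by simp [unitors_equal]
  assoc _ _ _ _ := by monoidal

/-- The `V`-functor from the unit `V`-category to `V` selecting the unit object. -/
def unitWeight : EnrichedFunctor V (UnitCat V) V where
  obj _ := 𝟙_ V
  map _ _ := eId V (𝟙_ V)
  map_id _ := Category.id_comp _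
  map_comp _ _ _ := by
    change (λ_ (𝟙_ V)).hom ≫ eId V (𝟙_ V) = _
    have h := e_id_comp V (𝟙_ V) (𝟙_ V)
    have e : (eId V (𝟙_ V) ⊗ₘ eId V (𝟙_ V)) ≫ eComp V (𝟙_ V) (𝟙_ V) (𝟙_ V) =
        (λ_ (𝟙_ V)).hom ≫ eId V (𝟙_ V) := by
      rw [MonoidalCategory.tensorHom_def', Category.assoc, ← cancel_epi (λ_ (𝟙_ V)).inv,
        Iso.inv_hom_id_assoc, ← leftUnitor_inv_naturality_assoc, h, Category.comp_id]
    exact e.symm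

end UnitCat
section Limits
variable (V) (C : Type u') [EnrichedCategory V C]

/-- `C` has powers: for `X : V` and `B : C` there are `P` and `X ⟶ C(P,B)` inducing isomorphisms
`C(A,P) ≅ [X, C(A,B)]` for all `A`. -/
def HasPowers : Prop :=
  ∀ (X : V) (B : C), ∃ (P : C) (κ : X ⟶ EnrichedCategory.Hom P B),
    ∀ A : C, IsIso (powerMap κ A)

variable {V C}

/-- The limit of `S` weighted by `Q` exists. -/
def HasWeightedLimit [HasLimits V] {D : Type v} [EnrichedCategory V D]
    (Q : EnrichedFunctor V D V) (S : EnrichedFunctor V D C) : Prop :=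
  ∃ (L : C) (η : WeightHom Q (homFrom S L)), ∀ B : C, IsIso (limitMap η B)

end Limits

section Model
variable (V)

/-- The pushout-product axiom, together with cofibrancy of the unit (which makes the unit axiom
of a monoidal model category automatic). -/
structure IsMonoidalModel [ModelCategory V] : Prop where
  cofibration_pushoutProduct {A B X Y : V} (f : A ⟶ B) (g : X ⟶ Y) :
    Cofibration f → Cofibration g →
      Cofibration ((Arrow.pushoutProduct.obj (Arrow.mk f)).obj (Arrow.mk g)).hom
  weakEquivalence_pushoutProduct {A B X Y : V} (f : A ⟶ B) (g : X ⟶ Y) :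
    Cofibration f → Cofibration g → (WeakEquivalence f ∨ WeakEquivalence g) →
      WeakEquivalence ((Arrow.pushoutProduct.obj (Arrow.mk f)).obj (Arrow.mk g)).hom
  isCofibrant_unit : IsCofibrant (𝟙_ V)

/-- An interval: a factorisation of the codiagonal of the unit as a cofibration `(d c)`
followed by a weak equivalence `e`. -/
structure Interval [ModelCategory V] where
  J : V
  d : 𝟙_ V ⟶ J
  c : 𝟙_ V ⟶ J
  e : J ⟶ 𝟙_ V
  d_e : d ≫ e = 𝟙 _
  c_e : c ≫ e = 𝟙 _
  cofibration : Cofibration (coprod.desc d c)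
  weakEquivalence : WeakEquivalence e

variable {V}

/-- A morphism `f : A ⟶ B` of `V` is shrinkable if it has a section `s` and there is a homotopy
`h : J ⟶ [A,A]` from `f ≫ s` to the identity, along some interval `J`, whose composite with
`[A,f]` is trivial, that is, factorises through `e : J ⟶ I`. -/
def Shrinkable [ModelCategory V] {A B : V} (f : A ⟶ B) : Prop :=
  ∃ (s : B ⟶ A) (j : Interval V) (h : j.J ⟶ (ihom A).obj A),
    s ≫ f = 𝟙 B ∧
    j.d ≫ h = MonoidalClosed.curry' (f ≫ s) ∧
    j.c ≫ h = MonoidalClosed.curry' (𝟙 A) ∧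
    ∃ k : 𝟙_ V ⟶ (ihom A).obj B, h ≫ (ihom A).map f = j.e ≫ k

/-- `p` is a pointwise trivial fibration. -/
def IsPointwiseTrivialFibration [ModelCategory V] {D : Type w} [EnrichedCategory V D]
    {F G : EnrichedFunctor V D V} (p : WeightHom F G) : Prop :=
  ∀ X : D, trivialFibrations V (p.app X)

variable [HasLimits V]

/-- A weight `Q : D → V` is cofibrant if `[D,V](Q,p)` is a trivial fibration for every pointwise
trivial fibration `p`. -/
def IsCofibrantWeight [ModelCategory V] {D : Type v} [EnrichedCategory V D]
    (Q : EnrichedFunctor V D V) : Prop :=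
  ∀ (F G : EnrichedFunctor V D V) (p : WeightHom F G), IsPointwiseTrivialFibration p →
    trivialFibrations V (natObjMap Q p)

variable (V) (C : Type u') [EnrichedCategory V C]

/-- `C` has enough cofibrantly-weighted limits: for every small `V`-category `D` and every
`V`-functor `P` from `D` to the unit `V`-category there are a cofibrant weight `Q` and a pointwise
trivial fibration from `Q` to the composite of `P` with the functor selecting the unit, such that
`C` has all `Q`-weighted limits. -/
def HasEnoughCofibrantlyWeightedLimits [ModelCategory V] : Prop :=
  ∀ (D : Type v) [EnrichedCategory V D] (P : EnrichedFunctor V D (UnitCat V)),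
    ∃ (Q : EnrichedFunctor V D V) (p : WeightHom Q (P.comp V (unitWeight V))),
      IsCofibrantWeight Q ∧ IsPointwiseTrivialFibration p ∧
        ∀ S : EnrichedFunctor V D C, HasWeightedLimit Q S

/-- `C` has `E`-weak colimits, `E` the class of shrinkable morphisms of `V`: for all small `D`,
weights `W : Dᵒᵖ → V` and `S : D → C` there are `L` and a `V`-natural `W ⟶ C(S-,L)` such that the
induced `C(L,A) ⟶ [Dᵒᵖ,V](W, C(S-,A))` is shrinkable for every `A`. -/
def HasShrinkableWeakColimits [ModelCategory V] : Prop :=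
  ∀ (D : Type v) [EnrichedCategory V D] (W : EnrichedFunctor V Dᵒᵖ V) (S : EnrichedFunctor V D C),
    ∃ (L : C) (η : WeightHom W (homTo S L)), ∀ A : C, Shrinkable (colimitMap η A)

end Model

section Accessible

/-- A cocone in the underlying category of `C` is a conical colimit if it is a colimit there and
each `C(-,X)` sends it to a limit in `V`. -/
def IsConicalColimit {C : Type u'} [EnrichedCategory V C] {H : Type v} [SmallCategory H]
    {F : H ⥤ ForgetEnrichment V C} (c : Cocone F) : Prop :=
  Nonempty (IsColimit c) ∧
    ∀ X : ForgetEnrichment V C,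
      Nonempty (IsLimit (((eHomFunctor V (ForgetEnrichment V C)).flip.obj X).mapCone c.op))

variable (V)

/-- `A` is `κ`-presentable in the enriched sense: `C(A,-)` preserves conical `κ`-filtered
colimits. -/
def IsEnrichedPresentable {C : Type u'} [EnrichedCategory V C] (κ : Cardinal.{v})
    [Fact κ.IsRegular] (A : ForgetEnrichment V C) : Prop :=
  ∀ (H : Type v) [SmallCategory H] [IsCardinalFiltered H κ] (F : H ⥤ ForgetEnrichment V C)
    (c : Cocone F), IsConicalColimit c →
      Nonempty (IsColimit ((eCoyoneda V A).mapCocone c))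

/-- `C` is `κ`-accessible as a `V`-category: it has conical `κ`-filtered colimits, and a set of
`κ`-presentable objects of which every object is a conical `κ`-filtered colimit. -/
structure IsEnrichedCardinalAccessible (C : Type u') [EnrichedCategory V C] (κ : Cardinal.{v})
    [Fact κ.IsRegular] : Prop where
  exists_colimit (H : Type v) [SmallCategory H] [IsCardinalFiltered H κ]
    (F : H ⥤ ForgetEnrichment V C) : ∃ c : Cocone F, IsConicalColimit c
  exists_generator : ∃ (ι : Type v) (G : ι → ForgetEnrichment V C),
    (∀ i, IsEnrichedPresentable V κ (G i)) ∧
      ∀ X : ForgetEnrichment V C, ∃ (H : Type v) (_ : SmallCategory H) (_ : IsCardinalFiltered H κ)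
        (F : H ⥤ ForgetEnrichment V C) (t : F ⟶ (Functor.const H).obj X),
        (∀ h, ∃ i, Nonempty (F.obj h ≅ G i)) ∧ IsConicalColimit ⟨X, t⟩

/-- `V` is locally `κ₀`-presentable as a monoidal category: the unit is `κ₀`-presentable and
`κ₀`-presentable objects are closed under the tensor product. -/
structure IsMonoidalLocallyPresentable (κ₀ : Cardinal.{v}) [Fact κ₀.IsRegular] : Prop where
  isCardinalLocallyPresentable : IsCardinalLocallyPresentable V κ₀
  unit : IsCardinalPresentable (𝟙_ V) κ₀
  tensor (X Y : V) : IsCardinalPresentable X κ₀ → IsCardinalPresentable Y κ₀ →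
    IsCardinalPresentable (X ⊗ Y) κ₀

/-- `C` is an accessible `V`-category: `κ`-accessible for some regular `κ ≥ κ₀`, where `V` is
locally `κ₀`-presentable as a monoidal category. -/
def IsEnrichedAccessible (C : Type u') [EnrichedCategory V C] : Prop :=
  ∃ (κ₀ κ : Cardinal.{v}) (_ : Fact κ₀.IsRegular) (_ : Fact κ.IsRegular),
    IsMonoidalLocallyPresentable V κ₀ ∧ κ₀ ≤ κ ∧ IsEnrichedCardinalAccessible V C κ

end Accessible

end
end EWeak

namespace EWeak
noncomputable section

variable {V : Type u} [Category.{v} V] [MonoidalCategory V] [SymmetricCategory V] [MonoidalClosed V]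

/-! ### Generalized elements of hom-objects and their action on `V`-valued functors -/

section Calculus

/-! Fix W and S and let F be the `V`-functor A ↦ [Dᵒᵖ,V](W, C(S-,A)), called `natFunctor W S`. A
cocone on L is a point ξ : I ⟶ F L, and its comparison maps are the evaluations C(L,A) ⟶ F A at ξ
(`colimitMap_weightHomOfPoint`). So a ξ is sought all of whose evaluations are shrinkable. F
preserves powers and every weighted limit that exists in C (`IsPower.natFunctor`,
`IsLimitCone.natFunctor`), and the proof is a homotopical general adjoint functor theorem for F.

Powers reduce shrinkability to a statement about points: ξ maps to every element of F, and two maps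
out of L that agree on ξ are homotopic over F (`IsHomotopyInitial`). The first condition, at a power
of A by F A, gives a section; the second, at a power of A by C(L,A), gives the homotopy
(`IsHomotopyInitial.shrinkable`).

To find such a ξ, take a small family (K i, x i) of elements mapping to all others. It spans a small
`V`-category of elements, augmented over the unit `V`-category. Let Q be a cofibrant weight with a
pointwise trivial fibration to the constant weight I, and L the Q-weighted limit of the K i; since F
preserves it, the augmentation and the x i give ξ. As I is cofibrant, each Q i ⟶ I has a section,
hence L ⟶ K i carrying ξ to x i, and ξ is weakly initial. As Q is cofibrant, [Q,Q] ⟶ [Q,I] is a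
trivial fibration, so all endomorphisms of L that come from endomorphisms of Q over I are homotopic
to the identity. If u, v : L ⟶ B agree on ξ, the same construction on the two elements (L,ξ) and
(B,uξ) gives e : L' ⟶ L with ue and ve homotopic. Weak initiality yields an endomorphism L ⟶ K i ⟶
L' ⟶ L of the above kind, whence u ∼ v (`exists_isHomotopyInitial`).

Accessibility supplies the small family. Given y : I ⟶ F A, write A as a κ-directed colimit of
generators. A subdiagram containing the stages through which y factors, closed under upper bounds of
fewer than κ members and under equalizing pairs that become equal in A, has a colimit B whose map to
A is monic on each C(G,-); then y lifts to B. The index posets of the various A are not bounded, so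
the subdiagram is parametrized by formal trees evaluated in the poset: the type of trees is fixed in
advance, hence only a small set of diagrams occurs (`exists_treeDiagram`,
`hasSolutionSet_natFunctor`). -/

lemma comp_tensorHom_eq {X Y Z X' Y' : V} (a : X ⟶ Y) (b : Y ⟶ Z) (h : X' ⟶ Y') :
    ((a ≫ b) ⊗ₘ h) = (a ⊗ₘ h) ≫ b ▷ _ := by
  rw [MonoidalCategory.tensorHom_def', MonoidalCategory.tensorHom_def', comp_whiskerRight,
    Category.assoc]

lemma tensorHom_comp_eq {X Y Z X' Y' : V} (h : X' ⟶ Y') (a : X ⟶ Y) (b : Y ⟶ Z) :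
    (h ⊗ₘ (a ≫ b)) = (h ⊗ₘ a) ≫ _ ◁ b := by
  rw [MonoidalCategory.tensorHom_def, MonoidalCategory.tensorHom_def,
    MonoidalCategory.whiskerLeft_comp, Category.assoc]

variable {C : Type u'} [EnrichedCategory V C]

/-- Composition of generalized elements of hom-objects. -/
def hcomp {X Y : V} {A B D : C} (f : X ⟶ EnrichedCategory.Hom A B)
    (g : Y ⟶ EnrichedCategory.Hom B D) : X ⊗ Y ⟶ EnrichedCategory.Hom A D :=
  (f ⊗ₘ g) ≫ eComp V A B D

lemma hcomp_comp {X Y X' Y' : V} {A B D : C} (a : X' ⟶ X) (b : Y' ⟶ Y)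
    (f : X ⟶ EnrichedCategory.Hom A B) (g : Y ⟶ EnrichedCategory.Hom B D) :
    hcomp (a ≫ f) (b ≫ g) = (a ⊗ₘ b) ≫ hcomp f g := by
  simp only [hcomp, ← MonoidalCategory.tensorHom_comp_tensorHom, Category.assoc]

lemma hcomp_comp_left {X Y X' : V} {A B D : C} (a : X' ⟶ X)
    (f : X ⟶ EnrichedCategory.Hom A B) (g : Y ⟶ EnrichedCategory.Hom B D) :
    hcomp (a ≫ f) g = a ▷ Y ≫ hcomp f g := by
  have := hcomp_comp a (𝟙 Y) f g
  rwa [Category.id_comp, MonoidalCategory.tensorHom_id] at this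

lemma hcomp_comp_right {X Y Y' : V} {A B D : C} (b : Y' ⟶ Y)
    (f : X ⟶ EnrichedCategory.Hom A B) (g : Y ⟶ EnrichedCategory.Hom B D) :
    hcomp f (b ≫ g) = X ◁ b ≫ hcomp f g := by
  have := hcomp_comp (𝟙 X) b f g
  rwa [Category.id_comp, MonoidalCategory.id_tensorHom] at this

lemma hcomp_assoc {X Y Z : V} {A B D E : C} (f : X ⟶ EnrichedCategory.Hom A B)
    (g : Y ⟶ EnrichedCategory.Hom B D) (h : Z ⟶ EnrichedCategory.Hom D E) :
    hcomp (hcomp f g) h = (α_ X Y Z).hom ≫ hcomp f (hcomp g h) := by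
  rw [hcomp, hcomp, hcomp, hcomp, comp_tensorHom_eq, tensorHom_comp_eq, Category.assoc,
    Category.assoc, ← e_assoc', ← MonoidalCategory.associator_naturality_assoc]

lemma hcomp_eId {X : V} {A B : C} (f : X ⟶ EnrichedCategory.Hom A B) :
    hcomp f (eId V B) = (ρ_ X).hom ≫ f := by
  rw [hcomp, MonoidalCategory.tensorHom_def, Category.assoc, ← cancel_epi (ρ_ X).inv,
    Iso.inv_hom_id_assoc, ← rightUnitor_inv_naturality_assoc, e_comp_id, Category.comp_id]

lemma eId_hcomp {X : V} {A B : C} (f : X ⟶ EnrichedCategory.Hom A B) :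
    hcomp (eId V A) f = (λ_ X).hom ≫ f := by
  rw [hcomp, MonoidalCategory.tensorHom_def', Category.assoc, ← cancel_epi (λ_ X).inv,
    Iso.inv_hom_id_assoc, ← leftUnitor_inv_naturality_assoc, e_id_comp, Category.comp_id]

lemma hcomp_id_id (A B D : C) :
    hcomp (𝟙 (EnrichedCategory.Hom A B : V)) (𝟙 (EnrichedCategory.Hom B D : V)) =
      eComp V A B D := by
  rw [hcomp, MonoidalCategory.id_tensorHom_id, Category.id_comp]

section Act
variable (F : EnrichedFunctor V C V)

lemma act_eId (A : C) : F.obj A ◁ eId V A ≫ act F A A = (ρ_ _).hom := by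
  rw [act, ← MonoidalClosed.uncurry_natural_left, F.map_id]
  change MonoidalClosed.uncurry (MonoidalClosed.id _) = _
  rw [MonoidalClosed.id_eq, MonoidalClosed.uncurry_curry]

lemma act_eComp (A B D : C) : F.obj A ◁ eComp V A B D ≫ act F A D =
    (α_ _ _ _).inv ≫ act F A B ▷ _ ≫ act F B D := by
  rw [act, ← MonoidalClosed.uncurry_natural_left, F.map_comp]
  exact uncurry_eComp _ _

/-- The action of generalized elements of hom-objects on generalized elements of `F`. -/
def actOn {X Y : V} {A B : C} (t : X ⟶ F.obj A) (g : Y ⟶ EnrichedCategory.Hom A B) :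
    X ⊗ Y ⟶ F.obj B :=
  (t ⊗ₘ g) ≫ act F A B

lemma actOn_comp {X Y X' Y' : V} {A B : C} (a : X' ⟶ X) (b : Y' ⟶ Y)
    (f : X ⟶ F.obj A) (g : Y ⟶ EnrichedCategory.Hom A B) :
    actOn F (a ≫ f) (b ≫ g) = (a ⊗ₘ b) ≫ actOn F f g := by
  simp only [actOn, ← MonoidalCategory.tensorHom_comp_tensorHom, Category.assoc]

lemma actOn_comp_left {X Y X' : V} {A B : C} (a : X' ⟶ X)
    (f : X ⟶ F.obj A) (g : Y ⟶ EnrichedCategory.Hom A B) :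
    actOn F (a ≫ f) g = a ▷ Y ≫ actOn F f g := by
  have := actOn_comp F a (𝟙 Y) f g
  rwa [Category.id_comp, MonoidalCategory.tensorHom_id] at this

lemma actOn_comp_right {X Y Y' : V} {A B : C} (b : Y' ⟶ Y)
    (f : X ⟶ F.obj A) (g : Y ⟶ EnrichedCategory.Hom A B) :
    actOn F f (b ≫ g) = X ◁ b ≫ actOn F f g := by
  have := actOn_comp F (𝟙 X) b f g
  rwa [Category.id_comp, MonoidalCategory.id_tensorHom] at this

lemma actOn_assoc {X Y Z : V} {A B D : C} (t : X ⟶ F.obj A)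
    (g : Y ⟶ EnrichedCategory.Hom A B) (h : Z ⟶ EnrichedCategory.Hom B D) :
    actOn F (actOn F t g) h = (α_ X Y Z).hom ≫ actOn F t (hcomp g h) := by
  rw [actOn, actOn, actOn, hcomp, comp_tensorHom_eq, tensorHom_comp_eq, Category.assoc,
    Category.assoc, act_eComp, ← MonoidalCategory.associator_naturality_assoc,
    Iso.hom_inv_id_assoc]

lemma actOn_eId {X : V} {A : C} (t : X ⟶ F.obj A) :
    actOn F t (eId V A) = (ρ_ X).hom ≫ t := by
  rw [actOn, MonoidalCategory.tensorHom_def, Category.assoc, act_eId, rightUnitor_naturality]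

variable {F} in
/-- Naturality of a transformation of weights can be checked on the actions. -/
def WeightHom.ofAct {G : EnrichedFunctor V C V} (app : ∀ A, F.obj A ⟶ G.obj A)
    (h : ∀ A B, act F A B ≫ app B = app A ▷ _ ≫ act G A B) : WeightHom F G where
  app := app
  naturality A B := by
    apply MonoidalClosed.uncurry_injective
    rw [MonoidalClosed.uncurry_pre_app]
    exact (MonoidalClosed.uncurry_natural_right _ _).trans (h A B)

/-- A `V`-functor to `V` given by an action of hom-objects. -/
@[reducible]
def functorOfAct (obj : C → V) (a : ∀ A B, obj A ⊗ EnrichedCategory.Hom A B ⟶ obj B)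
    (ha : ∀ A, obj A ◁ eId V A ≫ a A A = (ρ_ _).hom)
    (hc : ∀ A B D, obj A ◁ eComp V A B D ≫ a A D = (α_ _ _ _).inv ≫ a A B ▷ _ ≫ a B D) :
    EnrichedFunctor V C V where
  obj := obj
  map A B := MonoidalClosed.curry (a A B)
  map_id A := by
    rw [← MonoidalClosed.curry_natural_left, ha]
    exact (MonoidalClosed.id_eq _).symm
  map_comp A B D := by
    apply MonoidalClosed.uncurry_injective
    erw [uncurry_eComp]
    rw [MonoidalClosed.uncurry_natural_left, MonoidalClosed.uncurry_curry,
      MonoidalClosed.uncurry_curry, MonoidalClosed.uncurry_curry, hc]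

lemma act_functorOfAct (obj : C → V) (a : ∀ A B, obj A ⊗ EnrichedCategory.Hom A B ⟶ obj B)
    (ha : ∀ A, obj A ◁ eId V A ≫ a A A = (ρ_ _).hom)
    (hc : ∀ A B D, obj A ◁ eComp V A B D ≫ a A D = (α_ _ _ _).inv ≫ a A B ▷ _ ≫ a B D) (A B : C) :
    act (functorOfAct obj a ha hc) A B = a A B :=
  MonoidalClosed.uncurry_curry _

/-- The evaluation of a global element `x` of `F A` at a generalized element of `C(A,B)`. -/
def evalAt {Y : V} {A B : C} (x : 𝟙_ V ⟶ F.obj A) (g : Y ⟶ EnrichedCategory.Hom A B) :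
    Y ⟶ F.obj B :=
  (λ_ Y).inv ≫ actOn F x g

lemma actOn_unit {Y : V} {A B : C} (x : 𝟙_ V ⟶ F.obj A) (g : Y ⟶ EnrichedCategory.Hom A B) :
    actOn F x g = (λ_ Y).hom ≫ evalAt F x g := by
  rw [evalAt, Iso.hom_inv_id_assoc]

lemma evalAt_comp {Y Y' : V} {A B : C} (x : 𝟙_ V ⟶ F.obj A) (a : Y' ⟶ Y)
    (g : Y ⟶ EnrichedCategory.Hom A B) : evalAt F x (a ≫ g) = a ≫ evalAt F x g := by
  rw [evalAt, evalAt, actOn_comp_right, leftUnitor_inv_naturality_assoc]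

lemma evalAt_hcomp {Y Z : V} {A B D : C} (x : 𝟙_ V ⟶ F.obj A)
    (g : Y ⟶ EnrichedCategory.Hom A B) (h : Z ⟶ EnrichedCategory.Hom B D) :
    evalAt F x (hcomp g h) = actOn F (evalAt F x g) h := by
  rw [evalAt, evalAt, actOn_comp_left, actOn_assoc]
  simp

lemma evalAt_eId {A : C} (x : 𝟙_ V ⟶ F.obj A) : evalAt F x (eId V A) = x := by
  rw [evalAt, actOn_eId, ← unitors_equal, Iso.inv_hom_id_assoc]

/-- Composable generalized elements lying over elements of `F` compose. -/
lemma evalAt_hcomp_of_eq {Y Z : V} {A B D : C} {x : 𝟙_ V ⟶ F.obj A} {y : 𝟙_ V ⟶ F.obj B}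
    {z : 𝟙_ V ⟶ F.obj D}
    {g : Y ⟶ EnrichedCategory.Hom A B} {h : Z ⟶ EnrichedCategory.Hom B D} {a : Y ⟶ 𝟙_ V}
    {b : Z ⟶ 𝟙_ V} (hg : evalAt F x g = a ≫ y) (hh : evalAt F y h = b ≫ z) :
    evalAt F x (hcomp g h) = (a ⊗ₘ b) ≫ (λ_ _).hom ≫ z := by
  rw [evalAt_hcomp, hg, actOn_comp_left, actOn_unit, hh, MonoidalCategory.tensorHom_def]
  simp

end Act

end Calculus

/-! ### Generalized elements of [D,V](Q,G) as natural families -/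

section Families

/-- Naturality of a family of morphisms `Z ⊗ Q i ⟶ G i`. -/
def IsNatFamily {D : Type w} [EnrichedCategory V D] (Q G : EnrichedFunctor V D V) {Z : V}
    (t : ∀ i, Z ⊗ Q.obj i ⟶ G.obj i) : Prop :=
  ∀ i j, t i ▷ EnrichedCategory.Hom i j ≫ act G i j = (α_ _ _ _).hom ≫ Z ◁ act Q i j ≫ t j

variable [HasLimits V] {D : Type v} [EnrichedCategory V D]

lemma natObj_hom_ext {F G : EnrichedFunctor V D V} {A : V} {f g : A ⟶ natObj F G}
    (h : ∀ X, f ≫ natObjπ F G X = g ≫ natObjπ F G X) : f = g := by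
  apply equalizer.hom_ext
  apply Pi.hom_ext
  intro X
  exact (Category.assoc _ _ _).trans ((h X).trans (Category.assoc _ _ _).symm)

variable (Q G : EnrichedFunctor V D V)

/-- The family `Z ⊗ Q i ⟶ G i` corresponding to a generalized element of `[D,V](Q,G)`. -/
def natFamily {Z : V} (f : Z ⟶ natObj Q G) (i : D) : Z ⊗ Q.obj i ⟶ G.obj i :=
  (β_ _ _).hom ≫ MonoidalClosed.uncurry (f ≫ natObjπ Q G i)

lemma natFamily_comp {Z Z' : V} (a : Z' ⟶ Z) (f : Z ⟶ natObj Q G) (i : D) :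
    natFamily Q G (a ≫ f) i = a ▷ _ ≫ natFamily Q G f i := by
  rw [natFamily, natFamily, Category.assoc, MonoidalClosed.uncurry_natural_left]
  simp

lemma natFamily_ext {Z : V} {f g : Z ⟶ natObj Q G}
    (h : ∀ i, natFamily Q G f i = natFamily Q G g i) : f = g := by
  apply natObj_hom_ext
  intro i
  apply MonoidalClosed.uncurry_injective
  exact (cancel_epi (β_ _ _).hom).1 (h i)

/-- Moves the parameter Z from the right, where currying puts it, to the left, where it fits `hcomp`
and `actOn`. The two equations differ by an invertible symmetry. -/
lemma wedge_iff_right {Z : V} (t : ∀ i, Z ⊗ Q.obj i ⟶ G.obj i) (i j : D) :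
    (_ ◁ (β_ _ _).hom ≫ (α_ _ _ _).inv ≫ ((β_ _ _).hom ≫ t i) ▷ _ ≫ act G i j =
        (α_ _ _ _).inv ≫ act Q i j ▷ Z ≫ ((β_ _ _).hom ≫ t j)) ↔
    t i ▷ EnrichedCategory.Hom i j ≫ act G i j = (α_ _ _ _).hom ≫ Z ◁ act Q i j ≫ t j := by
  rw [← cancel_epi ((α_ Z (Q.obj i) (EnrichedCategory.Hom i j)).hom ≫
    (β_ Z (Q.obj i ⊗ EnrichedCategory.Hom i j)).hom ≫ (α_ _ _ _).hom)]
  have e1 : ((α_ Z (Q.obj i) (EnrichedCategory.Hom i j)).hom ≫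
      (β_ Z (Q.obj i ⊗ EnrichedCategory.Hom i j)).hom ≫ (α_ _ _ _).hom) ≫
      _ ◁ (β_ _ _).hom ≫ (α_ _ _ _).inv ≫ ((β_ _ _).hom ≫ t i) ▷ _ ≫ act G i j =
      t i ▷ EnrichedCategory.Hom i j ≫ act G i j := by
    simp only [BraidedCategory.braiding_tensor_right_hom, Category.assoc, Iso.inv_hom_id_assoc,
      Iso.hom_inv_id_assoc, comp_whiskerRight]
    rw [← MonoidalCategory.whiskerLeft_comp_assoc, SymmetricCategory.symmetry]
    simp only [MonoidalCategory.whiskerLeft_id, Category.id_comp, Iso.hom_inv_id_assoc]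
    rw [← comp_whiskerRight_assoc, SymmetricCategory.symmetry]
    simp
  have e2 : ((α_ Z (Q.obj i) (EnrichedCategory.Hom i j)).hom ≫
      (β_ Z (Q.obj i ⊗ EnrichedCategory.Hom i j)).hom ≫ (α_ _ _ _).hom) ≫
      (α_ _ _ _).inv ≫ act Q i j ▷ Z ≫ ((β_ _ _).hom ≫ t j) =
      (α_ _ _ _).hom ≫ Z ◁ act Q i j ≫ t j := by
    simp only [Category.assoc, Iso.hom_inv_id_assoc]
    rw [← BraidedCategory.braiding_naturality_right_assoc, SymmetricCategory.symmetry_assoc]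
  rw [e1, e2]

lemma isNatFamily_natFamily {Z : V} (f : Z ⟶ natObj Q G) : IsNatFamily Q G (natFamily Q G f) := by
  intro i j
  rw [← wedge_iff_right]
  have := (wedge_iff Q G (fun i => f ≫ natObjπ Q G i) i j).1
    (by simp only [Category.assoc, natObjπ_wedge])
  simpa [natFamily] using this

variable {Q G}

/-- With `natFamily_ext` this says that [D,V](Q,G) represents natural families, so that ends need
not be unfolded again. -/
lemma exists_natFamily_eq {Z : V} {t : ∀ i, Z ⊗ Q.obj i ⟶ G.obj i} (ht : IsNatFamily Q G t) :
    ∃ f : Z ⟶ natObj Q G, ∀ i, natFamily Q G f i = t i := by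
  refine ⟨natObjLift Q G (fun i => MonoidalClosed.curry ((β_ _ _).hom ≫ t i)) fun i j => ?_, ?_⟩
  · refine (wedge_iff Q G (fun i => MonoidalClosed.curry ((β_ _ _).hom ≫ t i)) i j).2 ?_
    simp only [MonoidalClosed.uncurry_curry]
    exact (wedge_iff_right Q G t i j).2 (ht i j)
  · intro i
    simp [natFamily, MonoidalClosed.uncurry_curry]

lemma natFamily_natObjMap {G' : EnrichedFunctor V D V} (p : WeightHom G G') {Z : V}
    (f : Z ⟶ natObj Q G) (i : D) :
    natFamily Q G' (f ≫ natObjMap Q p) i = natFamily Q G f i ≫ p.app i := by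
  rw [natFamily, natFamily, natObjMap, Category.assoc, natObjLift_π, ← Category.assoc f,
    MonoidalClosed.uncurry_natural_right, Category.assoc]

end Families

end
end EWeak

namespace EWeak
noncomputable section

variable {V : Type u} [Category.{v} V] [MonoidalCategory V] [SymmetricCategory V] [MonoidalClosed V]
  [HasLimits V]

/-! ### The `V`-functor A ↦ [Dᵒᵖ,V](W, C(S-,A)) -/

section NatFunctor

variable {C : Type u'} [EnrichedCategory V C] {D : Type v} [EnrichedCategory V D]
  (W : EnrichedFunctor V Dᵒᵖ V) (S : EnrichedFunctor V D C)

/-- The family `W X ⊗ Z ⟶ C(S X, A)` corresponding to a generalized element of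
`[Dᵒᵖ,V](W, C(S-,A))`. -/
def leftFamily {A : C} {Z : V} (f : Z ⟶ natObj W (homTo S A)) (X : Dᵒᵖ) :
    W.obj X ⊗ Z ⟶ EnrichedCategory.Hom (S.obj X.unop) A :=
  MonoidalClosed.uncurry (f ≫ natObjπ W (homTo S A) X)

lemma leftFamily_comp {A : C} {Z Z' : V} (a : Z' ⟶ Z) (f : Z ⟶ natObj W (homTo S A)) (X : Dᵒᵖ) :
    leftFamily W S (a ≫ f) X = _ ◁ a ≫ leftFamily W S f X :=
  (congrArg MonoidalClosed.uncurry (Category.assoc a f (natObjπ W (homTo S A) X))).trans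
    (MonoidalClosed.uncurry_natural_left _ _)

lemma leftFamily_ext {A : C} {Z : V} {f g : Z ⟶ natObj W (homTo S A)}
    (h : ∀ X, leftFamily W S f X = leftFamily W S g X) : f = g :=
  natObj_hom_ext fun X => MonoidalClosed.uncurry_injective (h X)

/-- The action of a weight `W : Dᵒᵖ → V`, written on the left. -/
def leftAct (X Y : Dᵒᵖ) : EnrichedCategory.Hom Y.unop X.unop ⊗ W.obj X ⟶ W.obj Y :=
  (β_ (EnrichedCategory.Hom Y.unop X.unop) (W.obj X)).hom ≫ act W X Y

/-- Naturality of a family `W X ⊗ Z ⟶ C(S X, A)`. -/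
def IsLeftNatFamily {A : C} {Z : V}
    (t : ∀ X : Dᵒᵖ, W.obj X ⊗ Z ⟶ EnrichedCategory.Hom (S.obj X.unop) A) : Prop :=
  ∀ X Y : Dᵒᵖ, hcomp (S.map Y.unop X.unop) (t X) = (α_ _ _ _).inv ≫ leftAct W X Y ▷ Z ≫ t Y

/-- Counterpart of `wedge_iff_right` for contravariant weights: with W X on the left and the
parameter on the right, naturality is an equation between composites in C. -/
lemma wedge_iff_left {A P R : C} {E X Y Z : V} (s : E ⟶ EnrichedCategory.Hom R P)
    (a : X ⊗ E ⟶ Y) (t : X ⊗ Z ⟶ EnrichedCategory.Hom P A)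
    (t' : Y ⊗ Z ⟶ EnrichedCategory.Hom R A) :
    (X ◁ (β_ E Z).hom ≫ (α_ _ _ _).inv ≫ t ▷ _ ≫ _ ◁ s ≫ (β_ _ _).hom ≫ eComp V R P A =
      (α_ _ _ _).inv ≫ a ▷ Z ≫ t') ↔
    hcomp s t = (α_ _ _ _).inv ≫ ((β_ E X).hom ≫ a) ▷ Z ≫ t' := by
  rw [← cancel_epi ((α_ E X Z).inv ≫ (β_ E X).hom ▷ Z ≫ (α_ _ _ _).hom)]
  have h := BraidedCategory.braiding_tensor_right_hom E X Z
  have e1 : ((α_ E X Z).inv ≫ (β_ E X).hom ▷ Z ≫ (α_ _ _ _).hom) ≫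
      X ◁ (β_ E Z).hom ≫ (α_ _ _ _).inv ≫ t ▷ _ ≫ _ ◁ s ≫ (β_ _ _).hom ≫ eComp V R P A =
      hcomp s t := by
    simp only [Category.assoc]
    rw [← reassoc_of% h, ← BraidedCategory.braiding_naturality_right_assoc,
      ← BraidedCategory.braiding_naturality_left_assoc, SymmetricCategory.symmetry_assoc, hcomp,
      MonoidalCategory.tensorHom_def', Category.assoc]
  rw [e1]
  simp

lemma act_homTo (A : C) (X Y : Dᵒᵖ) : act (homTo S A) X Y =
    _ ◁ S.map Y.unop X.unop ≫ (β_ _ _).hom ≫ eComp V (S.obj Y.unop) (S.obj X.unop) A :=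
  (act_comp_functor (opFunctor S) (yo A) X Y).trans
    (congrArg (fun f => _ ◁ S.map Y.unop X.unop ≫ f) (act_yo A _ _))

lemma wedge_iff_isLeftNat {A : C} {Z : V}
    (t : ∀ X : Dᵒᵖ, W.obj X ⊗ Z ⟶ EnrichedCategory.Hom (S.obj X.unop) A) (X Y : Dᵒᵖ) :
    (W.obj X ◁ (β_ (EnrichedCategory.Hom X Y) Z).hom ≫ (α_ _ _ _).inv ≫ t X ▷ _ ≫
        act (homTo S A) X Y = (α_ _ _ _).inv ≫ act W X Y ▷ Z ≫ t Y) ↔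
    hcomp (S.map Y.unop X.unop) (t X) = (α_ _ _ _).inv ≫ leftAct W X Y ▷ Z ≫ t Y := by
  refine Iff.trans ?_ (wedge_iff_left (S.map Y.unop X.unop) (act W X Y) (t X) (t Y))
  have h := congrArg (fun f => W.obj X ◁ (β_ (EnrichedCategory.Hom X Y) Z).hom ≫
    (α_ _ _ _).inv ≫ t X ▷ _ ≫ f) (act_homTo S A X Y)
  exact ⟨fun e => h.symm.trans e, fun e => h.trans e⟩

lemma isLeftNatFamily_leftFamily {A : C} {Z : V} (f : Z ⟶ natObj W (homTo S A)) :
    IsLeftNatFamily W S (leftFamily W S f) := fun X Y =>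
  (wedge_iff_isLeftNat W S (leftFamily W S f) X Y).1
    ((wedge_iff W (homTo S A) (fun i => f ≫ natObjπ W (homTo S A) i) X Y).1
      (by simp only [Category.assoc, natObjπ_wedge]))

variable {W S}

/-- The generalized element of `[Dᵒᵖ,V](W, C(S-,A))` corresponding to a natural family. -/
def leftLift {A : C} {Z : V}
    (t : ∀ X : Dᵒᵖ, W.obj X ⊗ Z ⟶ EnrichedCategory.Hom (S.obj X.unop) A)
    (ht : IsLeftNatFamily W S t) : Z ⟶ natObj W (homTo S A) :=
  natObjLift W (homTo S A) (fun X => MonoidalClosed.curry (t X)) fun X Y => by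
    refine (wedge_iff W (homTo S A) (fun X => MonoidalClosed.curry (t X)) X Y).2 ?_
    have h (X : Dᵒᵖ) : MonoidalClosed.uncurry (MonoidalClosed.curry (t X)) = t X :=
      MonoidalClosed.uncurry_curry _
    exact (wedge_iff_isLeftNat W S (fun X => MonoidalClosed.uncurry (MonoidalClosed.curry (t X)))
      X Y).2 (by simpa only [h] using ht X Y)

@[simp]
lemma leftFamily_leftLift {A : C} {Z : V}
    (t : ∀ X : Dᵒᵖ, W.obj X ⊗ Z ⟶ EnrichedCategory.Hom (S.obj X.unop) A)
    (ht : IsLeftNatFamily W S t) (X : Dᵒᵖ) : leftFamily W S (leftLift t ht) X = t X :=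
  (congrArg MonoidalClosed.uncurry (natObjLift_π W (homTo S A) _ _ X)).trans
    (MonoidalClosed.uncurry_curry _)

lemma IsLeftNatFamily.hcomp_right {A B : C} {Z Z' : V}
    {t : ∀ X : Dᵒᵖ, W.obj X ⊗ Z ⟶ EnrichedCategory.Hom (S.obj X.unop) A}
    (ht : IsLeftNatFamily W S t) (g : Z' ⟶ EnrichedCategory.Hom A B) :
    IsLeftNatFamily W S (fun X => (α_ _ _ _).inv ≫ hcomp (t X) g) := by
  intro X Y
  have h := congrArg (fun s => hcomp s g) (ht X Y)
  simp only [hcomp_assoc, hcomp_comp_left] at h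
  rw [hcomp_comp_right, ← cancel_epi (EnrichedCategory.Hom Y.unop X.unop ◁ (α_ _ _ _).hom),
    ← MonoidalCategory.whiskerLeft_comp_assoc, Iso.hom_inv_id, MonoidalCategory.whiskerLeft_id,
    Category.id_comp, ← cancel_epi (α_ _ _ _).hom, h]
  simp

variable (W S)

/-- The `V`-functor `A ↦ [Dᵒᵖ,V](W, C(S-,A))`. -/
@[reducible]
def natFunctor : EnrichedFunctor V C V :=
  functorOfAct (fun A => natObj W (homTo S A))
    (fun A B => leftLift (fun X => (α_ _ _ _).inv ≫ hcomp (leftFamily W S (𝟙 _) X) (𝟙 _))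
      ((isLeftNatFamily_leftFamily W S _).hcomp_right _))
    (fun A => by
      apply leftFamily_ext
      intro X
      have h := leftFamily_comp W S (ρ_ (natObj W (homTo S A))).hom (𝟙 _) X
      rw [Category.comp_id] at h
      rw [leftFamily_comp, leftFamily_leftLift, associator_inv_naturality_right_assoc,
        ← hcomp_comp_right, Category.comp_id, hcomp_eId, h]
      simp)
    (fun A B E => by
      apply leftFamily_ext
      intro X
      have h : ∀ {A B : C} {Z : V} (a : Z ⟶ natObj W (homTo S A) ⊗ EnrichedCategory.Hom A B),
          leftFamily W S (a ≫ leftLift (fun X => (α_ _ _ _).inv ≫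
            hcomp (leftFamily W S (𝟙 (natObj W (homTo S A))) X)
              (𝟙 (EnrichedCategory.Hom A B)))
            ((isLeftNatFamily_leftFamily W S _).hcomp_right _)) X =
          W.obj X ◁ a ≫ (α_ _ _ _).inv ≫ hcomp (leftFamily W S (𝟙 _) X) (𝟙 _) := by
        intros
        rw [leftFamily_comp, leftFamily_leftLift]
      rw [h, ← Category.assoc (α_ _ _ _).inv, h]
      have h2 : W.obj X ◁ leftLift (fun X => (α_ _ _ _).inv ≫
            hcomp (leftFamily W S (𝟙 (natObj W (homTo S A))) X)
              (𝟙 (EnrichedCategory.Hom A B)))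
            ((isLeftNatFamily_leftFamily W S _).hcomp_right _) ≫ leftFamily W S (𝟙 _) X =
          (α_ _ _ _).inv ≫ hcomp (leftFamily W S (𝟙 _) X) (𝟙 _) := by
        rw [← leftFamily_comp, Category.comp_id, leftFamily_leftLift]
      rw [associator_inv_naturality_right_assoc, ← hcomp_comp_right, Category.comp_id,
        MonoidalCategory.whiskerLeft_comp, Category.assoc,
        associator_inv_naturality_middle_assoc, ← hcomp_comp_left, h2, hcomp_comp_left,
        hcomp_assoc, hcomp_id_id]
      simp)

/-- Componentwise, the action of `natFunctor` is composition in C; preservation of limits and powers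
rests on this formula. -/
lemma leftFamily_actOn {A B : C} {Z Z' : V} (t : Z ⟶ (natFunctor W S).obj A)
    (g : Z' ⟶ EnrichedCategory.Hom A B) (X : Dᵒᵖ) :
    leftFamily W S (actOn (natFunctor W S) t g) X =
      (α_ _ _ _).inv ≫ hcomp (leftFamily W S t X) g := by
  have h : leftFamily W S t X = W.obj X ◁ t ≫ leftFamily W S (𝟙 _) X := by
    rw [← leftFamily_comp]
    exact congrArg (fun s => leftFamily W S s X) (Category.comp_id t).symm
  have h2 : act (natFunctor W S) A B =
    leftLift (fun X => (α_ _ _ _).inv ≫ hcomp (leftFamily W S (𝟙 _) X) (𝟙 _))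
      ((isLeftNatFamily_leftFamily W S _).hcomp_right _) := act_functorOfAct _ _ _ _ A B
  rw [actOn, h2, h]
  refine (leftFamily_comp W S _ _ X).trans ?_
  rw [leftFamily_leftLift]
  conv_rhs => rw [← Category.comp_id g]
  rw [hcomp_comp]
  simp [MonoidalCategory.tensorHom_def]

end NatFunctor

/-! ### Preservation of weighted limits and powers -/

section Limiting

variable {C : Type u'} [EnrichedCategory V C]

section
variable {D : Type v} [EnrichedCategory V D]
  {Q : EnrichedFunctor V D V} {S : EnrichedFunctor V D C} {L : C}

/-- The components of a cone `Q ⟶ C(L,S-)`. -/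
def coneApp (η : WeightHom Q (homFrom S L)) (i : D) : Q.obj i ⟶ EnrichedCategory.Hom L (S.obj i) :=
  η.app i

lemma act_coneApp (η : WeightHom Q (homFrom S L)) (i j : D) :
    act Q i j ≫ coneApp η j = hcomp (coneApp η i) (S.map i j) := by
  have h : act Q i j ≫ coneApp η j = coneApp η i ▷ _ ≫ act (homFrom S L) i j := η.act_comp i j
  have h2 : act (homFrom S L) i j = _ ◁ S.map i j ≫ eComp V L (S.obj i) (S.obj j) :=
    (act_comp_functor S (coyo L) i j).trans
      (congrArg (fun f => _ ◁ S.map i j ≫ f) (act_coyo (V := V) L (S.obj i) (S.obj j)))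
  rw [hcomp, MonoidalCategory.tensorHom_def, Category.assoc]
  exact h.trans (congrArg (fun f => coneApp η i ▷ _ ≫ f) h2)

/-- `F` sends the cone `η : Q ⟶ C(L,S-)` to a weighted limit. -/
def IsLimiting (F : EnrichedFunctor V C V) (η : WeightHom Q (homFrom S L)) : Prop :=
  ∀ ⦃Z : V⦄ (t : ∀ i, Z ⊗ Q.obj i ⟶ F.obj (S.obj i)),
    (∀ i j, actOn F (t i) (S.map i j) = (α_ _ _ _).hom ≫ Z ◁ act Q i j ≫ t j) →
    ∃! g : Z ⟶ F.obj L, ∀ i, actOn F g (coneApp η i) = t i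

/-- The cone `η : Q ⟶ C(L,S-)` is a weighted limit. -/
def IsLimitCone (η : WeightHom Q (homFrom S L)) : Prop :=
  ∀ ⦃B : C⦄ ⦃Z : V⦄ (t : ∀ i, Z ⊗ Q.obj i ⟶ EnrichedCategory.Hom B (S.obj i)),
    (∀ i j, hcomp (t i) (S.map i j) = (α_ _ _ _).hom ≫ Z ◁ act Q i j ≫ t j) →
    ∃! g : Z ⟶ EnrichedCategory.Hom B L, ∀ i, hcomp g (coneApp η i) = t i

lemma IsLimiting.hom_ext {F : EnrichedFunctor V C V} {η : WeightHom Q (homFrom S L)}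
    (h : IsLimiting F η) {Z : V} {g g' : Z ⟶ F.obj L}
    (hg : ∀ i, actOn F g (coneApp η i) = actOn F g' (coneApp η i)) : g = g' := by
  refine (h (fun i => actOn F g (coneApp η i)) fun i j => ?_).unique (fun _ => rfl)
    fun i => (hg i).symm
  rw [actOn_assoc, ← act_coneApp, actOn_comp_right]

lemma IsLimitCone.hom_ext {η : WeightHom Q (homFrom S L)}
    (h : IsLimitCone η) {B : C} {Z : V} {g g' : Z ⟶ EnrichedCategory.Hom B L}
    (hg : ∀ i, hcomp g (coneApp η i) = hcomp g' (coneApp η i)) : g = g' := by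
  refine (h (fun i => hcomp g (coneApp η i)) fun i j => ?_).unique (fun _ => rfl)
    fun i => (hg i).symm
  rw [hcomp_assoc, ← act_coneApp, hcomp_comp_right]

lemma natFamily_limitMap (η : WeightHom Q (homFrom S L)) (B : C) {Z : V}
    (g : Z ⟶ EnrichedCategory.Hom B L) (i : D) :
    natFamily Q (homFrom S B) (g ≫ limitMap η B) i = hcomp g (coneApp η i) := by
  have h : (g ≫ limitMap η B) ≫ natObjπ Q (homFrom S B) i = MonoidalClosed.curry
      (_ ◁ g ≫ coneApp η i ▷ _ ≫ (β_ _ _).hom ≫ eComp V B L (S.obj i)) := by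
    rw [MonoidalClosed.curry_natural_left, Category.assoc]
    exact congrArg (fun f => g ≫ f) (natObjLift_π _ _ _ _ i)
  have h2 := congrArg (fun f => (β_ _ _).hom ≫ MonoidalClosed.uncurry f) h
  have h3 := MonoidalClosed.uncurry_curry
    (_ ◁ g ≫ coneApp η i ▷ _ ≫ (β_ _ _).hom ≫ eComp V B L (S.obj i))
  refine h2.trans ((congrArg (fun f => (β_ _ _).hom ≫ f) h3).trans ?_)
  rw [hcomp, MonoidalCategory.tensorHom_def,
    ← BraidedCategory.braiding_naturality_left_assoc,
    ← BraidedCategory.braiding_naturality_right_assoc, SymmetricCategory.symmetry_assoc,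
    Category.assoc]

/-- Passes from invertible comparison maps to unique factorization of generalized elements, in which
no hom-object in V has to be formed. -/
lemma isLimitCone (η : WeightHom Q (homFrom S L)) (hη : ∀ B, IsIso (limitMap η B)) :
    IsLimitCone η := by
  intro B Z t ht
  have hB := hη B
  have ht' : IsNatFamily Q (homFrom S B) t := by
    intro i j
    refine Eq.trans ?_ (ht i j)
    rw [hcomp, MonoidalCategory.tensorHom_def, Category.assoc]
    exact congrArg (fun f => t i ▷ _ ≫ f) ((act_comp_functor S (coyo B) i j).trans
      (congrArg (fun f => _ ◁ S.map i j ≫ f) (act_coyo (V := V) B (S.obj i) (S.obj j))))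
  obtain ⟨f, hf⟩ := exists_natFamily_eq ht'
  refine ⟨f ≫ inv (limitMap η B), fun i => ?_, fun g hg => ?_⟩
  · refine (natFamily_limitMap η B _ i).symm.trans ?_
    rw [Category.assoc, IsIso.inv_hom_id, Category.comp_id, hf]
  · rw [IsIso.eq_comp_inv]
    apply natFamily_ext
    intro i
    exact (natFamily_limitMap η B g i).trans ((hg i).trans (hf i).symm)

/-- Representables preserve the limit, and so does an end of powers of them: the factorization is
solved for each X at stage W X ⊗ Z, and uniqueness makes the solutions natural in X. -/
lemma IsLimitCone.natFunctor {η : WeightHom Q (homFrom S L)}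
    (hη : IsLimitCone η) {E : Type v} [EnrichedCategory V E]
    (W : EnrichedFunctor V Eᵒᵖ V) (T : EnrichedFunctor V E C) :
    IsLimiting (natFunctor W T) η := by
  intro Z t ht
  have key : ∀ (X : Eᵒᵖ) (i j : D),
      hcomp ((α_ (W.obj X) Z (Q.obj i)).hom ≫ leftFamily W T (t i) X) (S.map i j) =
      (α_ _ _ _).hom ≫ _ ◁ act Q i j ≫ (α_ (W.obj X) Z (Q.obj j)).hom ≫ leftFamily W T (t j) X := by
    intro X i j
    have h := congrArg (fun s => leftFamily W T s X) (ht i j)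
    simp only [leftFamily_actOn, leftFamily_comp] at h
    rw [Iso.inv_comp_eq] at h
    rw [hcomp_comp_left, h]
    simp
  choose g hg hg' using fun X => hη _ (key X)
  have hgX : ∀ X i, hcomp (g X) (coneApp η i) =
      (α_ (W.obj X) Z (Q.obj i)).hom ≫ leftFamily W T (t i) X := hg
  have hnat : IsLeftNatFamily W T g := by
    intro X Y
    apply hη.hom_ext
    intro i
    rw [hcomp_assoc, hgX, hcomp_comp_right, isLeftNatFamily_leftFamily W T (t i) X Y, hcomp_comp_left,
      hcomp_comp_left, hgX]
    simp
  refine ⟨leftLift g hnat, fun i => ?_, fun g' hg'' => ?_⟩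
  · apply leftFamily_ext
    intro X
    rw [leftFamily_actOn, leftFamily_leftLift, hgX, Iso.inv_hom_id_assoc]
  · apply leftFamily_ext
    intro X
    rw [leftFamily_leftLift]
    apply hg'
    intro i
    have := congrArg (fun s => leftFamily W T s X) (hg'' i)
    simp only [leftFamily_actOn] at this
    rw [← this, Iso.hom_inv_id_assoc]

end

section
variable {X : V} {P B : C}

/-- `F` sends `κ : X ⟶ C(P,B)` to a power. -/
def IsPowering (F : EnrichedFunctor V C V) (κ : X ⟶ EnrichedCategory.Hom P B) : Prop :=
  ∀ ⦃Z : V⦄ (t : Z ⊗ X ⟶ F.obj B), ∃! g : Z ⟶ F.obj P, actOn F g κ = t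

/-- `κ : X ⟶ C(P,B)` exhibits `P` as a power. -/
def IsPower (κ : X ⟶ EnrichedCategory.Hom P B) : Prop :=
  ∀ ⦃A : C⦄ ⦃Z : V⦄ (t : Z ⊗ X ⟶ EnrichedCategory.Hom A B),
    ∃! g : Z ⟶ EnrichedCategory.Hom A P, hcomp g κ = t

lemma hcomp_eq_uncurry_powerMap (κ : X ⟶ EnrichedCategory.Hom P B) (A : C) {Z : V}
    (g : Z ⟶ EnrichedCategory.Hom A P) :
    hcomp g κ = (β_ _ _).hom ≫ MonoidalClosed.uncurry (g ≫ powerMap κ A) := by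
  rw [powerMap, ← MonoidalClosed.curry_natural_left, MonoidalClosed.uncurry_curry, hcomp,
    MonoidalCategory.tensorHom_def, ← BraidedCategory.braiding_naturality_left_assoc,
    ← BraidedCategory.braiding_naturality_right_assoc, SymmetricCategory.symmetry_assoc,
    Category.assoc]

lemma isPower (κ : X ⟶ EnrichedCategory.Hom P B) (hκ : ∀ A, IsIso (powerMap κ A)) :
    IsPower κ := by
  intro A Z t
  have hA := hκ A
  refine ⟨MonoidalClosed.curry ((β_ _ _).hom ≫ t) ≫ inv (powerMap κ A), ?_, fun g hg => ?_⟩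
  · refine (hcomp_eq_uncurry_powerMap κ A _).trans ?_
    rw [Category.assoc, IsIso.inv_hom_id, Category.comp_id, MonoidalClosed.uncurry_curry,
      SymmetricCategory.symmetry_assoc]
  · rw [IsIso.eq_comp_inv]
    apply MonoidalClosed.uncurry_injective
    rw [MonoidalClosed.uncurry_curry, ← cancel_epi (β_ _ _).hom, SymmetricCategory.symmetry_assoc,
      ← hg]
    exact (hcomp_eq_uncurry_powerMap κ A g).symm

/-- Same argument as for weighted limits: solve at each stage W Y ⊗ Z, then obtain naturality from
uniqueness. -/
lemma IsPower.natFunctor {κ : X ⟶ EnrichedCategory.Hom P B}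
    (hκ : IsPower κ) {E : Type v} [EnrichedCategory V E]
    (W : EnrichedFunctor V Eᵒᵖ V) (T : EnrichedFunctor V E C) :
    IsPowering (natFunctor W T) κ := by
  intro Z t
  choose g hg hg' using fun Y : Eᵒᵖ => hκ ((α_ (W.obj Y) Z X).hom ≫ leftFamily W T t Y)
  have hgX : ∀ Y, hcomp (g Y) κ = (α_ (W.obj Y) Z X).hom ≫ leftFamily W T t Y := hg
  have hnat : IsLeftNatFamily W T g := by
    intro Y Y'
    apply (hκ _).unique rfl
    rw [hcomp_assoc, hgX, hcomp_comp_right, isLeftNatFamily_leftFamily W T t Y Y',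
      hcomp_comp_left, hcomp_comp_left, hgX]
    simp
  refine ⟨leftLift g hnat, ?_, fun g' hg'' => ?_⟩
  · apply leftFamily_ext
    intro X
    rw [leftFamily_actOn, leftFamily_leftLift, hgX, Iso.inv_hom_id_assoc]
  · apply leftFamily_ext
    intro X
    rw [leftFamily_leftLift]
    apply hg'
    have := congrArg (fun s => leftFamily W T s X) hg''
    simp only [leftFamily_actOn] at this
    rw [← this, Iso.hom_inv_id_assoc]

end

end Limiting

end
end EWeak

namespace EWeak
noncomputable section

variable {V : Type u} [Category.{v} V] [MonoidalCategory V] [SymmetricCategory V] [MonoidalClosed V]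

/-! ### Composition with points and evaluation at an element -/

section Points

variable {C : Type u'} [EnrichedCategory V C]

/-- Precomposition with a point of `C(A,B)`. -/
def preComp {A B : C} (u : 𝟙_ V ⟶ EnrichedCategory.Hom A B) (D : C) :
    (EnrichedCategory.Hom B D : V) ⟶ EnrichedCategory.Hom A D :=
  (λ_ _).inv ≫ hcomp u (𝟙 _)

/-- Postcomposition with a point of `C(B,D)`. -/
def postComp {B D : C} (u : 𝟙_ V ⟶ EnrichedCategory.Hom B D) (A : C) :
    (EnrichedCategory.Hom A B : V) ⟶ EnrichedCategory.Hom A D :=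
  (ρ_ _).inv ≫ hcomp (𝟙 _) u

lemma comp_preComp {A B D : C} (u : 𝟙_ V ⟶ EnrichedCategory.Hom A B) {Y : V}
    (g : Y ⟶ EnrichedCategory.Hom B D) : g ≫ preComp u D = (λ_ _).inv ≫ hcomp u g := by
  rw [preComp, leftUnitor_inv_naturality_assoc, ← hcomp_comp_right, Category.comp_id]

lemma comp_postComp {A B D : C} (u : 𝟙_ V ⟶ EnrichedCategory.Hom B D) {Y : V}
    (g : Y ⟶ EnrichedCategory.Hom A B) : g ≫ postComp u A = (ρ_ _).inv ≫ hcomp g u := by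
  rw [postComp, rightUnitor_inv_naturality_assoc, ← hcomp_comp_left, Category.comp_id]

lemma hcomp_point {A B D : C} (u : 𝟙_ V ⟶ EnrichedCategory.Hom A B) {Y : V}
    (g : Y ⟶ EnrichedCategory.Hom B D) : hcomp u g = (λ_ _).hom ≫ g ≫ preComp u D := by
  rw [comp_preComp, Iso.hom_inv_id_assoc]

lemma hcomp_preComp {A B D E : C} (u : 𝟙_ V ⟶ EnrichedCategory.Hom A B) {X Y : V}
    (f : X ⟶ EnrichedCategory.Hom B D) (g : Y ⟶ EnrichedCategory.Hom D E) :
    hcomp (f ≫ preComp u D) g = hcomp f g ≫ preComp u E := by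
  rw [comp_preComp, comp_preComp, hcomp_comp_left, hcomp_assoc]
  simp

lemma preComp_preComp {A B D : C} (u : 𝟙_ V ⟶ EnrichedCategory.Hom A B)
    (w : 𝟙_ V ⟶ EnrichedCategory.Hom B D) (E : C) :
    preComp (w ≫ preComp u D) E = preComp w E ≫ preComp u E := by
  rw [preComp, hcomp_preComp, ← Category.assoc]
  rfl

lemma point_postComp {A B D : C} (u : 𝟙_ V ⟶ EnrichedCategory.Hom A B)
    (w : 𝟙_ V ⟶ EnrichedCategory.Hom B D) : u ≫ postComp w A = w ≫ preComp u D := by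
  rw [comp_preComp, comp_postComp, unitors_inv_equal]

lemma eId_postComp {A B : C} (u : 𝟙_ V ⟶ EnrichedCategory.Hom A B) :
    eId V A ≫ postComp u A = u := by
  rw [comp_postComp, eId_hcomp, unitors_equal, Iso.inv_hom_id_assoc]

variable (F : EnrichedFunctor V C V)

/-- The map `C(A,B) ⟶ F B` given by evaluation at `x : I ⟶ F A`. -/
def evalMap {A : C} (x : 𝟙_ V ⟶ F.obj A) (B : C) :
    (EnrichedCategory.Hom A B : V) ⟶ F.obj B :=
  evalAt F x (𝟙 _)

lemma comp_evalMap {A B : C} (x : 𝟙_ V ⟶ F.obj A) {Y : V} (g : Y ⟶ EnrichedCategory.Hom A B) :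
    g ≫ evalMap F x B = evalAt F x g := by
  rw [evalMap, ← evalAt_comp, Category.comp_id]

lemma evalAt_preComp {A B D : C} (x : 𝟙_ V ⟶ F.obj A) (u : 𝟙_ V ⟶ EnrichedCategory.Hom A B)
    {Y : V} (g : Y ⟶ EnrichedCategory.Hom B D) :
    evalAt F x (g ≫ preComp u D) = evalAt F (evalAt F x u) g := by
  rw [comp_preComp, evalAt_comp, evalAt_hcomp, actOn_unit, Iso.inv_hom_id_assoc]

lemma preComp_evalMap {A B : C} (x : 𝟙_ V ⟶ F.obj A) (u : 𝟙_ V ⟶ EnrichedCategory.Hom A B)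
    (D : C) : preComp u D ≫ evalMap F x D = evalMap F (evalAt F x u) D := by
  have := evalAt_preComp F x u (𝟙 (EnrichedCategory.Hom B D))
  rwa [Category.id_comp, ← comp_evalMap] at this

/-- Composition with u lies over the map F u, so homotopies over F can be pushed forward along u. -/
lemma postComp_evalMap {A B D : C} (x : 𝟙_ V ⟶ F.obj A) (u : 𝟙_ V ⟶ EnrichedCategory.Hom B D) :
    postComp u A ≫ evalMap F x D = evalMap F x B ≫ (ρ_ _).inv ≫ actOn F (𝟙 _) u := by
  rw [comp_evalMap, postComp, evalAt_comp, evalAt_hcomp, evalMap, rightUnitor_inv_naturality_assoc,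
    ← actOn_comp_left, Category.comp_id]

end Points

/-! ### Homotopies of points over a map -/

section Homotopy

variable [ModelCategory V]

/-- Two points of `X` are homotopic over `π : X ⟶ Y` if an interval connects them whose image
in `Y` is constant. -/
def HomotopicOver {X Y : V} (π : X ⟶ Y) (a b : 𝟙_ V ⟶ X) : Prop :=
  ∃ (j : Interval V) (h : j.J ⟶ X), j.d ≫ h = a ∧ j.c ≫ h = b ∧
    ∃ k : 𝟙_ V ⟶ Y, h ≫ π = j.e ≫ k

lemma HomotopicOver.map {X Y X' Y' : V} {π : X ⟶ Y} {π' : X' ⟶ Y'} {a b : 𝟙_ V ⟶ X}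
    (h : HomotopicOver π a b) (m : X ⟶ X') (n : Y ⟶ Y') (e : m ≫ π' = π ≫ n) :
    HomotopicOver π' (a ≫ m) (b ≫ m) := by
  obtain ⟨j, h, rfl, rfl, k, hk⟩ := h
  exact ⟨j, h ≫ m, by simp, by simp, k ≫ n, by rw [Category.assoc, e, reassoc_of% hk]⟩

/-- Factor (d c) : I + I ⟶ T as a cofibration followed by a trivial fibration; the middle object is
an interval because T is weakly equivalent to I. -/
lemma exists_interval {T : V} (d c : 𝟙_ V ⟶ T) (e : T ⟶ 𝟙_ V) (hd : d ≫ e = 𝟙 _)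
    (hc : c ≫ e = 𝟙 _) [WeakEquivalence e] :
    ∃ (j : Interval V) (p : j.J ⟶ T), j.d ≫ p = d ∧ j.c ≫ p = c ∧ p ≫ e = j.e := by
  let φ := MorphismProperty.factorizationData (cofibrations V) (trivialFibrations V)
    (coprod.desc d c)
  have h1 : coprod.inl ≫ φ.i ≫ φ.p = d := by rw [φ.fac, coprod.inl_desc]
  have h2 : coprod.inr ≫ φ.i ≫ φ.p = c := by rw [φ.fac, coprod.inr_desc]
  have : WeakEquivalence φ.p := ((mem_trivialFibrations_iff _).1 φ.hp).2
  exact ⟨{ J := φ.Z, d := coprod.inl ≫ φ.i, c := coprod.inr ≫ φ.i, e := φ.p ≫ e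
           d_e := by rw [Category.assoc, reassoc_of% h1, hd]
           c_e := by rw [Category.assoc, reassoc_of% h2, hc]
           cofibration := by
             have h3 : coprod.desc (coprod.inl ≫ φ.i) (coprod.inr ≫ φ.i) = φ.i :=
               coprod.hom_ext (coprod.inl_desc _ _) (coprod.inr_desc _ _)
             rw [h3]
             exact (cofibration_iff _).2 φ.hi
           weakEquivalence := inferInstance }, φ.p, by simpa using h1, by simpa using h2, rfl⟩

/-- A homotopy is a lift of (a b) : I + I ⟶ X along the cofibration I + I ⟶ J against π, over the
constant path. -/
lemma HomotopicOver.of_trivialFibration {X Y : V} {π : X ⟶ Y} (hπ : trivialFibrations V π)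
    {a b : 𝟙_ V ⟶ X} (e : a ≫ π = b ≫ π) : HomotopicOver π a b := by
  obtain ⟨h1, h2⟩ := (mem_trivialFibrations_iff _).1 hπ
  obtain ⟨j, p, -⟩ := exists_interval (𝟙 (𝟙_ V)) (𝟙 _) (𝟙 _) (by simp) (by simp)
  have := j.cofibration
  have sq : CommSq (coprod.desc a b) (coprod.desc j.d j.c) π (j.e ≫ a ≫ π) := ⟨by
    ext
    · rw [coprod.inl_desc_assoc, coprod.inl_desc_assoc, reassoc_of% j.d_e]
    · rw [coprod.inr_desc_assoc, coprod.inr_desc_assoc, reassoc_of% j.c_e, e]⟩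
  refine ⟨j, sq.lift, ?_, ?_, a ≫ π, sq.fac_right⟩
  · exact (coprod.inl_desc_assoc j.d j.c sq.lift).symm.trans
      (by rw [sq.fac_left, coprod.inl_desc])
  · exact (coprod.inr_desc_assoc j.d j.c sq.lift).symm.trans
      (by rw [sq.fac_left, coprod.inr_desc])

lemma exists_point_lift (hI : IsCofibrant (𝟙_ V)) {X : V} {p : X ⟶ 𝟙_ V}
    (hp : trivialFibrations V p) : ∃ q : 𝟙_ V ⟶ X, q ≫ p = 𝟙 _ := by
  obtain ⟨h1, h2⟩ := (mem_trivialFibrations_iff _).1 hp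
  have sq : CommSq (initial.to X) (initial.to (𝟙_ V)) p (𝟙 _) := ⟨Subsingleton.elim _ _⟩
  exact ⟨sq.lift, sq.fac_right⟩

/-- Glue the two intervals along a common endpoint. The pushout is still weakly equivalent to I, and
`exists_interval` restores the cofibration. -/
lemma HomotopicOver.trans (hI : IsCofibrant (𝟙_ V)) {X Y : V} {π : X ⟶ Y} {a b c : 𝟙_ V ⟶ X}
    (h : HomotopicOver π a b) (h' : HomotopicOver π b c) : HomotopicOver π a c := by
  obtain ⟨j, f, rfl, hb, k, hk⟩ := h
  obtain ⟨j', f', hb', rfl, k', hk'⟩ := h'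
  -- Both constant paths in Y take the value of the common endpoint b.
  have hkk : k = k' := by
    have e1 := congrArg (fun t => j.c ≫ t) hk
    have e2 := congrArg (fun t => j'.d ≫ t) hk'
    simp only [reassoc_of% hb, reassoc_of% hb', reassoc_of% j.c_e, reassoc_of% j'.d_e] at e1 e2
    exact e1.symm.trans e2
  subst hkk
  have := j.weakEquivalence
  have := j'.weakEquivalence
  have := j'.cofibration
  have hd : j'.d = coprod.inl ≫ coprod.desc j'.d j'.c := (coprod.inl_desc _ _).symm
  -- The injection I ⟶ I + I is a cofibration because I is cofibrant.
  have hd1 : Cofibration j'.d := by rw [hd]; infer_instance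
  have hd2 : WeakEquivalence j'.d := by
    have : WeakEquivalence (𝟙 (𝟙_ V)) := inferInstance
    exact weakEquivalence_of_postcomp_of_fac j'.d_e
  have hinl : trivialCofibrations V (pushout.inl j.c j'.d) :=
    MorphismProperty.of_isPushout (IsPushout.of_hasPushout j.c j'.d)
      (mem_trivialCofibrations _)
  have : WeakEquivalence (pushout.inl j.c j'.d) := ((mem_trivialCofibrations_iff _).1 hinl).2
  let e : pushout j.c j'.d ⟶ 𝟙_ V := pushout.desc j.e j'.e (by rw [j.c_e, j'.d_e])
  have he1 : pushout.inl _ _ ≫ e = j.e := pushout.inl_desc _ _ _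
  have he2 : pushout.inr _ _ ≫ e = j'.e := pushout.inr_desc _ _ _
  have : WeakEquivalence e := weakEquivalence_of_precomp_of_fac he1
  obtain ⟨i, p, hp1, hp2, hp3⟩ := exists_interval (j.d ≫ pushout.inl j.c j'.d)
    (j'.c ≫ pushout.inr j.c j'.d) e (by rw [Category.assoc, he1, j.d_e])
    (by rw [Category.assoc, he2, j'.c_e])
  let f'' : pushout j.c j'.d ⟶ X := pushout.desc f f' (hb.trans hb'.symm)
  refine ⟨i, p ≫ f'', ?_, ?_, k, ?_⟩
  · rw [reassoc_of% hp1, pushout.inl_desc]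
  · rw [reassoc_of% hp2, pushout.inr_desc]
  · have : f'' ≫ π = e ≫ k := by
      apply pushout.hom_ext
      · rw [pushout.inl_desc_assoc, hk, reassoc_of% he1]
      · rw [pushout.inr_desc_assoc, hk', reassoc_of% he2]
    rw [Category.assoc, this, reassoc_of% hp3]

end Homotopy

end
end EWeak

namespace EWeak
noncomputable section

variable {V : Type u} [Category.{v} V] [MonoidalCategory V] [SymmetricCategory V] [MonoidalClosed V]
  [HasLimits V]

/-! ### The `V`-category of elements and its cofibrantly weighted limit -/

section Elements

variable {C : Type u'} [EnrichedCategory V C] (F : EnrichedFunctor V C V) {ι : Type v} (K : ι → C)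
  (x : ∀ i, 𝟙_ V ⟶ F.obj (K i))

/-- The hom-objects of the `V`-category of elements of `F`. -/
def elHom (i j : ι) : V := pullback (evalMap F (x i) (K j)) (x j)

/-- The underlying morphism in `C` of a morphism of elements. -/
def elFst (i j : ι) : elHom F K x i j ⟶ EnrichedCategory.Hom (K i) (K j) := pullback.fst _ _

/-- The augmentation of the hom-objects of the `V`-category of elements. -/
def elSnd (i j : ι) : elHom F K x i j ⟶ 𝟙_ V := pullback.snd _ _

lemma evalAt_elFst (i j : ι) : evalAt F (x i) (elFst F K x i j) = elSnd F K x i j ≫ x j := by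
  rw [← comp_evalMap]
  exact pullback.condition

/-- A generalized element of a hom-object of the `V`-category of elements. -/
def elLift {i j : ι} {Y : V} (g : Y ⟶ EnrichedCategory.Hom (K i) (K j)) (a : Y ⟶ 𝟙_ V)
    (h : evalAt F (x i) g = a ≫ x j) : Y ⟶ elHom F K x i j :=
  pullback.lift g a (by rw [comp_evalMap, h])

@[simp]
lemma elLift_fst {i j : ι} {Y : V} (g : Y ⟶ EnrichedCategory.Hom (K i) (K j)) (a : Y ⟶ 𝟙_ V)
    (h : evalAt F (x i) g = a ≫ x j) : elLift F K x g a h ≫ elFst F K x i j = g :=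
  pullback.lift_fst _ _ _

@[simp]
lemma elLift_snd {i j : ι} {Y : V} (g : Y ⟶ EnrichedCategory.Hom (K i) (K j)) (a : Y ⟶ 𝟙_ V)
    (h : evalAt F (x i) g = a ≫ x j) : elLift F K x g a h ≫ elSnd F K x i j = a :=
  pullback.lift_snd _ _ _

lemma elHom_ext {i j : ι} {Y : V} {f g : Y ⟶ elHom F K x i j}
    (h1 : f ≫ elFst F K x i j = g ≫ elFst F K x i j)
    (h2 : f ≫ elSnd F K x i j = g ≫ elSnd F K x i j) : f = g :=
  pullback.hom_ext h1 h2

/-- Composition in the `V`-category of elements. -/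
def elComp (i j k : ι) : elHom F K x i j ⊗ elHom F K x j k ⟶ elHom F K x i k :=
  elLift F K x (hcomp (elFst F K x i j) (elFst F K x j k))
    ((elSnd F K x i j ⊗ₘ elSnd F K x j k) ≫ (λ_ _).hom)
    (by rw [evalAt_hcomp_of_eq F (evalAt_elFst F K x i j) (evalAt_elFst F K x j k), Category.assoc])

lemma elComp_fst (i j k : ι) : elComp F K x i j k ≫ elFst F K x i k =
    hcomp (elFst F K x i j) (elFst F K x j k) :=
  elLift_fst _ _ _ _ _ _

lemma elComp_snd (i j k : ι) : elComp F K x i j k ≫ elSnd F K x i k =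
    (elSnd F K x i j ⊗ₘ elSnd F K x j k) ≫ (λ_ _).hom :=
  elLift_snd _ _ _ _ _ _

/-- The full sub-`V`-category of the category of elements of `F` on a family of elements. -/
structure Elements (F : EnrichedFunctor V C V) {ι : Type v} (K : ι → C)
    (x : ∀ i, 𝟙_ V ⟶ F.obj (K i)) : Type v where
  idx : ι

/-- Identities in the `V`-category of elements. -/
def elId (i : ι) : 𝟙_ V ⟶ elHom F K x i i :=
  elLift F K x (eId V (K i)) (𝟙 _) (by rw [evalAt_eId, Category.id_comp])

lemma elId_fst (i : ι) : elId F K x i ≫ elFst F K x i i = eId V (K i) :=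
  elLift_fst _ _ _ _ _ _

lemma elId_snd (i : ι) : elId F K x i ≫ elSnd F K x i i = 𝟙 _ :=
  elLift_snd _ _ _ _ _ _

instance : EnrichedCategory V (Elements F K x) where
  Hom i j := elHom F K x i.idx j.idx
  id i := elId F K x i.idx
  comp i j k := elComp F K x i.idx j.idx k.idx
  id_comp i j := by
    apply elHom_ext
    · rw [Category.assoc, Category.assoc, elComp_fst, ← hcomp_comp_left, elId_fst, eId_hcomp]
      simp
    · rw [Category.assoc, Category.assoc, elComp_snd, ← MonoidalCategory.tensorHom_id,
        MonoidalCategory.tensorHom_comp_tensorHom_assoc, elId_snd, MonoidalCategory.id_tensorHom]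
      simp
  comp_id i j := by
    apply elHom_ext
    · rw [Category.assoc, Category.assoc, elComp_fst, ← hcomp_comp_right, elId_fst, hcomp_eId]
      simp
    · rw [Category.assoc, Category.assoc, elComp_snd, ← MonoidalCategory.id_tensorHom,
        MonoidalCategory.tensorHom_comp_tensorHom_assoc, elId_snd, MonoidalCategory.tensorHom_id,
        unitors_equal]
      simp
  assoc i j k l := by
    apply elHom_ext
    · rw [Category.assoc, Category.assoc, Category.assoc, elComp_fst, elComp_fst,
        ← hcomp_comp_left, ← hcomp_comp_right, elComp_fst, elComp_fst, hcomp_assoc,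
        Iso.inv_hom_id_assoc]
    · rw [Category.assoc, Category.assoc, Category.assoc, elComp_snd, elComp_snd,
        ← MonoidalCategory.tensorHom_id, MonoidalCategory.tensorHom_comp_tensorHom_assoc,
        elComp_snd, ← MonoidalCategory.id_tensorHom,
        MonoidalCategory.tensorHom_comp_tensorHom_assoc, elComp_snd, Category.id_comp,
        Category.id_comp, comp_tensorHom_eq, tensorHom_comp_eq, Category.assoc, Category.assoc,
        ← MonoidalCategory.associator_inv_naturality_assoc]
      congr 1
      monoidal

/-- The forgetful `V`-functor to `C`. -/
@[reducible]
def elForget : EnrichedFunctor V (Elements F K x) C where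
  obj i := K i.idx
  map i j := elFst F K x i.idx j.idx
  map_id i := elId_fst F K x i.idx
  map_comp i j k := elComp_fst F K x i.idx j.idx k.idx

/-- The augmentation `V`-functor to the unit `V`-category. -/
def elAug : EnrichedFunctor V (Elements F K x) (UnitCat V) where
  obj _ := ()
  map i j := elSnd F K x i.idx j.idx
  map_id i := elId_snd F K x i.idx
  map_comp i j k := elComp_snd F K x i.idx j.idx k.idx

variable {F K x}

/-- The components of an augmentation of a weight on a category of elements. -/
def augApp {Q : EnrichedFunctor V (Elements F K x) V}
    (p : WeightHom Q ((elAug F K x).comp V (unitWeight V))) (i : Elements F K x) : Q.obj i ⟶ 𝟙_ V :=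
  p.app i

lemma act_augApp {Q : EnrichedFunctor V (Elements F K x) V}
    (p : WeightHom Q ((elAug F K x).comp V (unitWeight V))) (i j : Elements F K x) :
    act Q i j ≫ augApp p j = (augApp p i ⊗ₘ elSnd F K x i.idx j.idx) ≫ (λ_ _).hom := by
  have h1 : act Q i j ≫ augApp p j =
      augApp p i ▷ _ ≫ act ((elAug F K x).comp V (unitWeight V)) i j := p.act_comp i j
  have h2 : act (unitWeight V) () () = (ρ_ (𝟙_ V)).hom := by
    change MonoidalClosed.uncurry (MonoidalClosed.id (𝟙_ V)) = _
    rw [MonoidalClosed.id_eq, MonoidalClosed.uncurry_curry]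
  have h3 : act ((elAug F K x).comp V (unitWeight V)) i j =
      _ ◁ elSnd F K x i.idx j.idx ≫ (λ_ _).hom := by
    rw [unitors_equal]
    exact (act_comp_functor (elAug F K x) (unitWeight V) i j).trans
      (congrArg (fun f => 𝟙_ V ◁ elSnd F K x i.idx j.idx ≫ f) h2)
  rw [MonoidalCategory.tensorHom_def, Category.assoc]
  exact h1.trans (congrArg (fun f => augApp p i ▷ _ ≫ f) h3)

variable (F K x) in
/-- A cofibrantly weighted limit of a family of elements of `F`, with its canonical element. -/
structure ElementsLimit [ModelCategory V] where
  Q : EnrichedFunctor V (Elements F K x) V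
  p : WeightHom Q ((elAug F K x).comp V (unitWeight V))
  cofibrant : IsCofibrantWeight Q
  trivialFibration : IsPointwiseTrivialFibration p
  L : C
  η : WeightHom Q (homFrom (elForget F K x) L)
  isLimit : IsLimitCone η
  isLimiting : IsLimiting F η
  ξ : 𝟙_ V ⟶ F.obj L
  evalAt_ξ (i : Elements F K x) : evalAt F ξ (coneApp η i) = augApp p i ≫ x i.idx

/-- The point ξ exists because F sends the limit cone to a limit: it corresponds to the family Q i ⟶
I ⟶ F (K i) given by the augmentation and x i. -/
lemma ElementsLimit.nonempty [ModelCategory V]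
    (hC : HasEnoughCofibrantlyWeightedLimits V C)
    (hF : ∀ {D : Type v} [EnrichedCategory V D] {Q : EnrichedFunctor V D V}
      {S : EnrichedFunctor V D C} {L : C} {η : WeightHom Q (homFrom S L)},
      IsLimitCone η → IsLimiting F η) : Nonempty (ElementsLimit F K x) := by
  obtain ⟨Q, p, hQ, hp, hS⟩ := hC (Elements F K x) (elAug F K x)
  obtain ⟨L, η, hη⟩ := hS (elForget F K x)
  have hl := isLimitCone η hη
  -- Compatibility of this family is the pullback square defining `elHom` together with naturality
  -- of the augmentation.
  obtain ⟨ξ, hξ, -⟩ := hF hl (Z := 𝟙_ V) (fun i => (λ_ _).hom ≫ augApp p i ≫ x i.idx) (by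
    intro i j
    rw [actOn_comp_left, actOn_comp_left, actOn_unit, evalAt_elFst, leftUnitor_naturality_assoc, reassoc_of% act_augApp p i j,
      MonoidalCategory.tensorHom_def]
    simp
    rfl)
  refine ⟨⟨Q, p, hQ, hp, L, η, hl, hF hl, ξ, fun i => ?_⟩⟩
  rw [evalAt, hξ, Iso.inv_hom_id_assoc]

namespace ElementsLimit

variable [ModelCategory V] (l : ElementsLimit F K x)

/-- The augmentation of the weight. -/
def aug (i : Elements F K x) : l.Q.obj i ⟶ 𝟙_ V := augApp l.p i

/-- The projections of the limit. -/
def π (i : Elements F K x) : l.Q.obj i ⟶ EnrichedCategory.Hom l.L (K i.idx) := coneApp l.η i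

lemma evalAt_π (i : Elements F K x) : evalAt F l.ξ (l.π i) = l.aug i ≫ x i.idx := l.evalAt_ξ i

lemma act_aug (i j : Elements F K x) :
    act l.Q i j ≫ l.aug j = (l.aug i ⊗ₘ elSnd F K x i.idx j.idx) ≫ (λ_ _).hom :=
  act_augApp l.p i j

lemma act_π (i j : Elements F K x) :
    act l.Q i j ≫ l.π j = hcomp (l.π i) (elFst F K x i.idx j.idx) :=
  act_coneApp l.η i j

lemma evalAt_aug {i j : Elements F K x} {q : 𝟙_ V ⟶ l.Q.obj i} (hq : q ≫ l.aug i = 𝟙 _)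
    {Y : V} (g : Y ⟶ elHom F K x i.idx j.idx) :
    evalAt l.Q q g ≫ l.aug j = g ≫ elSnd F K x i.idx j.idx := by
  have h : evalAt l.Q q g = (λ_ _).inv ≫ (q ⊗ₘ g) ≫ act l.Q i j := rfl
  rw [h, Category.assoc, Category.assoc, act_aug, ← Category.assoc (q ⊗ₘ g),
    MonoidalCategory.tensorHom_comp_tensorHom, hq, MonoidalCategory.id_tensorHom]
  simp

/-- A point q of Q i gives a map L ⟶ K i. Letting a morphism of elements i ⟶ j act on q and then
projecting amounts to composing it with that map. -/
lemma evalAt_comp_π {i j : Elements F K x} (q : 𝟙_ V ⟶ l.Q.obj i)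
    {Y : V} (g : Y ⟶ elHom F K x i.idx j.idx) :
    evalAt l.Q q g ≫ l.π j = (g ≫ elFst F K x i.idx j.idx) ≫ preComp (q ≫ l.π i) _ := by
  have h : evalAt l.Q q g = (λ_ _).inv ≫ (q ⊗ₘ g) ≫ act l.Q i j := rfl
  rw [h, Category.assoc, Category.assoc, act_π, ← hcomp_comp, comp_preComp]

lemma evalAt_π_comp {i : Elements F K x} {q : 𝟙_ V ⟶ l.Q.obj i} (hq : q ≫ l.aug i = 𝟙 _) :
    evalAt F l.ξ (q ≫ l.π i) = x i.idx := by
  rw [evalAt_comp, evalAt_π, reassoc_of% hq]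

section Endo

variable {i : Elements F K x} (g : 𝟙_ V ⟶ EnrichedCategory.Hom (K i.idx) l.L)
  (hg : evalAt F (x i.idx) g = l.ξ)

/-- The projections of the limit, composed with `g : K i ⟶ L`. -/
def projAlong (j : Elements F K x) : l.Q.obj j ⟶ elHom F K x i.idx j.idx :=
  elLift F K x (l.π j ≫ preComp g _) (l.aug j) (by rw [evalAt_preComp, hg, evalAt_π])

/-- This is naturality of Q ⟶ Hom(i,-), the transformation obtained from g; followed by the Yoneda
map Hom(i,-) ⟶ Q of q it gives `weightEndo`. -/
lemma act_projAlong (j k : Elements F K x) :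
    act l.Q j k ≫ l.projAlong g hg k =
      hcomp (C := Elements F K x) (l.projAlong g hg j) (𝟙 (EnrichedCategory.Hom j k)) := by
  have h : hcomp (C := Elements F K x) (l.projAlong g hg j) (𝟙 (EnrichedCategory.Hom j k)) =
    (l.projAlong g hg j ⊗ₘ 𝟙 (elHom F K x j.idx k.idx)) ≫ elComp F K x i.idx j.idx k.idx := rfl
  rw [h]
  apply elHom_ext
  · rw [Category.assoc, Category.assoc, elComp_fst, ← hcomp_comp, projAlong, projAlong, elLift_fst,
      elLift_fst, Category.id_comp, reassoc_of% l.act_π j k, hcomp_preComp]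
  · rw [Category.assoc, Category.assoc, elComp_snd, ← Category.assoc (_ ⊗ₘ _),
      MonoidalCategory.tensorHom_comp_tensorHom, projAlong, projAlong, elLift_snd, elLift_snd,
      Category.id_comp, act_aug]

/-- The endomorphism of the weight induced by a point `q` of `Q i` and `g : K i ⟶ L`. -/
def weightEndo (q : 𝟙_ V ⟶ l.Q.obj i) : WeightHom l.Q l.Q :=
  WeightHom.ofAct (fun j => evalAt l.Q q (l.projAlong g hg j)) fun j k => by
    have h : evalAt l.Q q (l.projAlong g hg j) ▷ _ ≫ act l.Q j k =
        actOn l.Q (evalAt l.Q q (l.projAlong g hg j)) (𝟙 (EnrichedCategory.Hom j k)) := by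
      rw [actOn, MonoidalCategory.tensorHom_id]
    rw [h, ← evalAt_hcomp, ← act_projAlong]
    exact (evalAt_comp l.Q q _ _).symm

lemma weightEndo_aug {q : 𝟙_ V ⟶ l.Q.obj i} (hq : q ≫ l.aug i = 𝟙 _) (j : Elements F K x) :
    (l.weightEndo g hg q).app j ≫ l.aug j = l.aug j :=
  (l.evalAt_aug hq _).trans (elLift_snd _ _ _ _ _ _)

/-- Identifies the endomorphism of L induced by `weightEndo` as the composite L ⟶ K i ⟶ L of q's
projection and g. -/
lemma weightEndo_π (q : 𝟙_ V ⟶ l.Q.obj i) (j : Elements F K x) :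
    (l.weightEndo g hg q).app j ≫ l.π j = l.π j ≫ preComp (g ≫ preComp (q ≫ l.π i) _) _ := by
  refine (l.evalAt_comp_π q _).trans ?_
  rw [projAlong, elLift_fst, Category.assoc, preComp_preComp]

end Endo

end ElementsLimit

end Elements

end
end EWeak

/-! ### Homotopy-initial elements -/

namespace EWeak
noncomputable section

variable {V : Type u} [Category.{v} V] [MonoidalCategory V] [SymmetricCategory V] [MonoidalClosed V]
  [HasLimits V]

lemma WeightHom.exists_name {D : Type v} [EnrichedCategory V D] {Q G : EnrichedFunctor V D V}
    (φ : WeightHom Q G) :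
    ∃ f : 𝟙_ V ⟶ natObj Q G, ∀ i, natFamily Q G f i = (λ_ _).hom ≫ φ.app i := by
  refine exists_natFamily_eq (Q := Q) (G := G) (t := fun i => (λ_ _).hom ≫ φ.app i) fun i j => ?_
  rw [comp_whiskerRight, Category.assoc, ← φ.act_comp]
  simp

variable [ModelCategory V] {C : Type u'} [EnrichedCategory V C] {F : EnrichedFunctor V C V}

namespace ElementsLimit

variable {ι : Type v} {K : ι → C} {x : ∀ i, 𝟙_ V ⟶ F.obj (K i)} (l : ElementsLimit F K x)

/-- Points of `C(L,L)` induced by endomorphisms of the weight over the unit are homotopic. -/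
lemma homotopicOver_of_weightHom {φ ψ : WeightHom l.Q l.Q}
    (hφ : ∀ j, φ.app j ≫ l.aug j = l.aug j) (hψ : ∀ j, ψ.app j ≫ l.aug j = l.aug j)
    {a b : 𝟙_ V ⟶ EnrichedCategory.Hom l.L l.L}
    (ha : ∀ j, hcomp a (l.π j) = (λ_ _).hom ≫ φ.app j ≫ l.π j)
    (hb : ∀ j, hcomp b (l.π j) = (λ_ _).hom ≫ ψ.app j ≫ l.π j) :
    HomotopicOver (evalMap F l.ξ l.L) a b := by
  obtain ⟨f, hf⟩ := φ.exists_name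
  obtain ⟨g, hg⟩ := ψ.exists_name
  -- An endomorphism of Q over I becomes the augmentation itself in [Q,I], so φ and ψ have the same
  -- image there.
  have aux : ∀ {χ : WeightHom l.Q l.Q} {r : 𝟙_ V ⟶ natObj l.Q l.Q},
      (∀ j, χ.app j ≫ l.aug j = l.aug j) →
      (∀ i, natFamily l.Q l.Q r i = (λ_ _).hom ≫ χ.app i) → ∀ i,
      natFamily l.Q _ (r ≫ natObjMap l.Q l.p) i = (λ_ _).hom ≫ l.aug i := by
    intro χ r hχ hr i
    rw [natFamily_natObjMap, hr, Category.assoc]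
    exact congrArg (fun t => (λ_ _).hom ≫ t) (hχ i)
  have hfg : f ≫ natObjMap l.Q l.p = g ≫ natObjMap l.Q l.p :=
    natFamily_ext _ _ fun i => (aux hφ hf i).trans (aux hψ hg i).symm
  obtain ⟨j, h, hd, hc, k, hk⟩ :=
    HomotopicOver.of_trivialFibration (l.cofibrant _ _ l.p l.trivialFibration) hfg
  have hk' : k = f ≫ natObjMap l.Q l.p := by
    have := congrArg (fun t => j.d ≫ t) hk
    simp only [reassoc_of% hd, reassoc_of% j.d_e] at this
    exact this.symm
  have haug : ∀ i, natFamily l.Q l.Q h i ≫ l.aug i = j.e ▷ _ ≫ (λ_ _).hom ≫ l.aug i := by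
    intro i
    have h1 := natFamily_natObjMap l.p h i
    rw [hk, hk', natFamily_comp] at h1
    exact h1.symm.trans (congrArg (fun t => j.e ▷ _ ≫ t) (aux hφ hf i))
  -- The homotopy in [Q,Q], followed by the projections, is a cone with parameter J, and so a path
  -- in C(L,L).
  obtain ⟨H, hH, -⟩ := l.isLimit (fun i => natFamily l.Q l.Q h i ≫ l.π i) (by
    intro i i'
    have h1 := isNatFamily_natFamily l.Q l.Q h i i'
    rw [hcomp_comp_left, ← reassoc_of% h1, l.act_π])
  have hH' : ∀ i, hcomp H (l.π i) = natFamily l.Q l.Q h i ≫ l.π i := hH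
  refine ⟨j, H, l.isLimit.hom_ext fun i => ?_, l.isLimit.hom_ext fun i => ?_, l.ξ, ?_⟩
  · refine Eq.trans ?_ (ha i).symm
    refine (hcomp_comp_left _ _ _).trans ?_
    refine (congrArg (fun t => _ ▷ _ ≫ t) (hH' i)).trans ?_
    rw [← Category.assoc, ← natFamily_comp, hd, hf, Category.assoc]
  · refine Eq.trans ?_ (hb i).symm
    refine (hcomp_comp_left _ _ _).trans ?_
    refine (congrArg (fun t => _ ▷ _ ≫ t) (hH' i)).trans ?_
    rw [← Category.assoc, ← natFamily_comp, hc, hg, Category.assoc]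
  -- Since F preserves the limit, constancy in F L may be tested after projecting. There the path is
  -- seen only through the augmentation, where it is constant.
  · apply l.isLimiting.hom_ext
    intro i
    have h1 : actOn F (H ≫ evalMap F l.ξ l.L) (l.π i) = natFamily l.Q l.Q h i ≫ l.aug i ≫ x i.idx := by
      rw [comp_evalMap, ← evalAt_hcomp, hH', evalAt_comp, l.evalAt_π]
    have h2 : actOn F (j.e ≫ l.ξ) (l.π i) = j.e ▷ _ ≫ (λ_ _).hom ≫ l.aug i ≫ x i.idx := by
      rw [actOn_comp_left, actOn_unit, l.evalAt_π]
    refine h1.trans (Eq.trans ?_ h2.symm)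
    rw [reassoc_of% haug i]

/-- The composite L ⟶ K i ⟶ L and the identity both come from endomorphisms of Q over I. Both
directions are stated, so symmetry of the relation is not needed. -/
lemma homotopicOver_endo {i : Elements F K x} {g : 𝟙_ V ⟶ EnrichedCategory.Hom (K i.idx) l.L}
    (hg : evalAt F (x i.idx) g = l.ξ) {q : 𝟙_ V ⟶ l.Q.obj i} (hq : q ≫ l.aug i = 𝟙 _) :
    HomotopicOver (evalMap F l.ξ l.L) (eId V l.L) (g ≫ preComp (q ≫ l.π i) _) ∧
      HomotopicOver (evalMap F l.ξ l.L) (g ≫ preComp (q ≫ l.π i) _) (eId V l.L) := by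
  let ψ : WeightHom l.Q l.Q := WeightHom.ofAct (fun j => 𝟙 _) (by simp)
  have h1 : ∀ j, ψ.app j ≫ l.aug j = l.aug j := fun j => Category.id_comp _
  have h2 := l.weightEndo_aug g hg hq
  have h3 : ∀ j, hcomp (eId V l.L) (l.π j) = (λ_ _).hom ≫ ψ.app j ≫ l.π j := fun j => by
    rw [eId_hcomp]
    exact congrArg _ (Category.id_comp _).symm
  have h4 : ∀ j, hcomp (g ≫ preComp (q ≫ l.π i) _) (l.π j) =
      (λ_ _).hom ≫ (l.weightEndo g hg q).app j ≫ l.π j := fun j => by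
    rw [weightEndo_π, hcomp_point]
  exact ⟨l.homotopicOver_of_weightHom h1 h2 h3 h4, l.homotopicOver_of_weightHom h2 h1 h4 h3⟩

end ElementsLimit

/-- An element of `F` is weakly initial, homotopically: it maps to every element of `F`, and any
two such maps are homotopic. -/
structure IsHomotopyInitial {L : C} (ξ : 𝟙_ V ⟶ F.obj L) : Prop where
  exists_map {B : C} (y : 𝟙_ V ⟶ F.obj B) :
    ∃ u : 𝟙_ V ⟶ EnrichedCategory.Hom L B, evalAt F ξ u = y
  homotopic {B : C} (u v : 𝟙_ V ⟶ EnrichedCategory.Hom L B) (h : evalAt F ξ u = evalAt F ξ v) :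
    HomotopicOver (evalMap F ξ B) u v

lemma exists_isHomotopyInitial (hI : IsCofibrant (𝟙_ V))
    (hlim : ∀ {ι : Type v} (K : ι → C) (x : ∀ i, 𝟙_ V ⟶ F.obj (K i)),
      Nonempty (ElementsLimit F K x))
    {ι : Type v} (K : ι → C) (x : ∀ i, 𝟙_ V ⟶ F.obj (K i))
    (hK : ∀ (B : C) (y : 𝟙_ V ⟶ F.obj B), ∃ (i : ι) (u : 𝟙_ V ⟶ EnrichedCategory.Hom (K i) B),
      evalAt F (x i) u = y) :
    ∃ (L : C) (ξ : 𝟙_ V ⟶ F.obj L), IsHomotopyInitial ξ := by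
  obtain ⟨l⟩ := hlim K x
  choose q hq using fun i => exists_point_lift hI (l.trivialFibration i)
  have hq' : ∀ i, q i ≫ l.aug i = 𝟙 _ := hq
  refine ⟨l.L, l.ξ, fun {B} y => ?_, fun {B} u v huv => ?_⟩
  · obtain ⟨i, u, hu⟩ := hK B y
    refine ⟨u ≫ preComp (q ⟨i⟩ ≫ l.π ⟨i⟩) _, ?_⟩
    rw [evalAt_preComp, l.evalAt_π_comp (hq' _), hu]
  -- The limit over the two elements (L,ξ) and (B,uξ), in whose category of elements u and v are
  -- parallel, plays the role of a homotopy equalizer of u and v.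
  · let K' : ULift.{v} Bool → C := fun b => cond b.down l.L B
    let x' : ∀ b, 𝟙_ V ⟶ F.obj (K' b) := fun b => match b with
      | ⟨true⟩ => l.ξ
      | ⟨false⟩ => evalAt F l.ξ u
    obtain ⟨l'⟩ := hlim K' x'
    let o : Elements F K' x' := ⟨⟨true⟩⟩
    let t : Elements F K' x' := ⟨⟨false⟩⟩
    obtain ⟨r, hr⟩ := exists_point_lift hI (l'.trivialFibration o)
    have hr' : r ≫ l'.aug o = 𝟙 _ := hr
    let e : 𝟙_ V ⟶ EnrichedCategory.Hom l'.L l.L := r ≫ l'.π o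
    have he : evalAt F l'.ξ e = l.ξ := l'.evalAt_π_comp hr'
    let u' : 𝟙_ V ⟶ elHom F K' x' o.idx t.idx := elLift F K' x' u (𝟙 _) (Category.id_comp _).symm
    let v' : 𝟙_ V ⟶ elHom F K' x' o.idx t.idx :=
      elLift F K' x' v (𝟙 _) (huv.symm.trans (Category.id_comp _).symm)
    -- The points of Q' t obtained from u and v both lie over the identity of I, and Q' t ⟶ I is a
    -- trivial fibration; projecting the homotopy to C(L',B) gives ue ∼ ve.
    have h0 : HomotopicOver (l'.aug t) (evalAt l'.Q r u') (evalAt l'.Q r v') :=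
      HomotopicOver.of_trivialFibration (l'.trivialFibration t)
        (((l'.evalAt_aug hr' u').trans (elLift_snd _ _ _ _ _ _)).trans
          ((l'.evalAt_aug hr' v').trans (elLift_snd _ _ _ _ _ _)).symm)
    have h1 := h0.map (π' := evalMap F l'.ξ B) (l'.π t) (evalAt F l.ξ u)
      ((comp_evalMap F l'.ξ (l'.π t)).trans (l'.evalAt_π t))
    have e1 : evalAt l'.Q r u' ≫ l'.π t = u ≫ preComp e B :=
      (l'.evalAt_comp_π r u').trans (congrArg (fun s => s ≫ preComp e B) (elLift_fst _ _ _ _ _ _))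
    have e2 : evalAt l'.Q r v' ≫ l'.π t = v ≫ preComp e B :=
      (l'.evalAt_comp_π r v').trans (congrArg (fun s => s ≫ preComp e B) (elLift_fst _ _ _ _ _ _))
    have h2 : HomotopicOver (evalMap F l'.ξ B) (u ≫ preComp e B) (v ≫ preComp e B) :=
      e1 ▸ e2 ▸ h1
    -- Weak initiality of the given family yields a way back K i ⟶ L', and with L ⟶ K i an
    -- endomorphism of L through e.
    obtain ⟨i, k, hk⟩ := hK l'.L l'.ξ
    have h3 := h2.map (π' := evalMap F (x i) B) (preComp k B) (𝟙 _)
      (by rw [preComp_evalMap, hk, Category.comp_id])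
    have h4 := h3.map (π' := evalMap F l.ξ B) (preComp (q ⟨i⟩ ≫ l.π ⟨i⟩) B) (𝟙 _)
      (by rw [preComp_evalMap, l.evalAt_π_comp (hq' _), Category.comp_id])
    have hg : evalAt F (x i) (e ≫ preComp k _) = l.ξ := by rw [evalAt_preComp, hk, he]
    obtain ⟨h5, h6⟩ := l.homotopicOver_endo (i := ⟨i⟩) hg (hq' ⟨i⟩)
    have key : ∀ w : 𝟙_ V ⟶ EnrichedCategory.Hom l.L B,
        ((e ≫ preComp k _) ≫ preComp (q ⟨i⟩ ≫ l.π ⟨i⟩) _) ≫ postComp w _ =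
        ((w ≫ preComp e B) ≫ preComp k B) ≫ preComp (q ⟨i⟩ ≫ l.π ⟨i⟩) B := by
      intro w
      rw [point_postComp, preComp_preComp, preComp_preComp]
      simp
    -- With w the endomorphism L ⟶ K i ⟶ L' ⟶ L, the chain is u ∼ uw ∼ vw ∼ v.
    have h7 := h5.map (postComp u l.L) _ (postComp_evalMap F l.ξ u)
    have h8 := h6.map (postComp v l.L) _ (postComp_evalMap F l.ξ v)
    rw [eId_postComp, key] at h7 h8
    exact (h7.trans hI h4).trans hI h8

end
end EWeak

/-! ### From homotopy-initial elements to shrinkable comparison maps -/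

namespace EWeak
noncomputable section

variable {V : Type u} [Category.{v} V] [MonoidalCategory V] [SymmetricCategory V] [MonoidalClosed V]
  [HasLimits V] {C : Type u'} [EnrichedCategory V C]

lemma IsHomotopyInitial.shrinkable [ModelCategory V] {F : EnrichedFunctor V C V} {L : C}
    {ξ : 𝟙_ V ⟶ F.obj L} (hξ : IsHomotopyInitial ξ) (hpow : HasPowers V C)
    (hF : ∀ {X : V} {P B : C} {κ : X ⟶ EnrichedCategory.Hom P B}, IsPower κ → IsPowering F κ)
    (A : C) : Shrinkable (evalMap F ξ A) := by
  -- For P the power of A by F A, points of F P are endomorphisms of F A. A map L ⟶ P carrying ξ to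
  -- the identity is, transposed, a section.
  obtain ⟨s, hs⟩ : ∃ s : F.obj A ⟶ EnrichedCategory.Hom L A, s ≫ evalMap F ξ A = 𝟙 _ := by
    obtain ⟨P, κ, hκ⟩ := hpow (F.obj A) A
    obtain ⟨z, hz, -⟩ := hF (isPower κ hκ) (Z := 𝟙_ V) (λ_ _).hom
    obtain ⟨u, hu⟩ := hξ.exists_map z
    refine ⟨κ ≫ preComp u A, ?_⟩
    rw [comp_evalMap, evalAt_preComp, hu, evalAt, hz, Iso.inv_hom_id]
  -- Now points of C(L,P) are endomorphisms of C(L,A): a is evaluation followed by s, and b is the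
  -- identity.
  obtain ⟨P, κ, hκ⟩ := hpow (EnrichedCategory.Hom L A) A
  have hP := isPower κ hκ
  obtain ⟨a, ha, -⟩ := hP (Z := 𝟙_ V) ((λ_ _).hom ≫ evalMap F ξ A ≫ s)
  obtain ⟨b, hb, -⟩ := hP (A := L) (Z := 𝟙_ V) (λ_ _).hom
  -- In F P, the power of F A by C(L,A), both become the evaluation map, since s is a section.
  have hab : evalAt F ξ a = evalAt F ξ b := by
    apply (hF hP ((λ_ _).hom ≫ evalMap F ξ A)).unique
    · rw [← evalAt_hcomp, ha, ← comp_evalMap, Category.assoc, Category.assoc, hs, Category.comp_id]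
    · rw [← evalAt_hcomp, hb, ← comp_evalMap]
  obtain ⟨j, h, hd, hc, k, hk⟩ := hξ.homotopic a b hab
  have key : ∀ {Y : V} (g : Y ⟶ EnrichedCategory.Hom L P),
      MonoidalClosed.uncurry (g ≫ powerMap κ L) = (β_ _ _).hom ≫ hcomp g κ := by
    intro Y g
    rw [hcomp_eq_uncurry_powerMap, SymmetricCategory.symmetry_assoc]
  refine ⟨s, j, h ≫ powerMap κ L, hs, ?_, ?_, MonoidalClosed.curry ((β_ _ _).hom ≫ actOn F k κ), ?_⟩
  · rw [← Category.assoc, hd]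
    apply MonoidalClosed.uncurry_injective
    rw [key, ha, MonoidalClosed.curry', MonoidalClosed.uncurry_curry,
      braiding_tensorUnit_right]
    simp
  · rw [← Category.assoc, hc]
    apply MonoidalClosed.uncurry_injective
    rw [key, hb, MonoidalClosed.curry', MonoidalClosed.uncurry_curry,
      braiding_tensorUnit_right]
    simp
  · apply MonoidalClosed.uncurry_injective
    rw [MonoidalClosed.uncurry_natural_right, key, MonoidalClosed.uncurry_natural_left,
      MonoidalClosed.uncurry_curry, Category.assoc, comp_evalMap, evalAt_hcomp, ← comp_evalMap, hk,
      actOn_comp_left, BraidedCategory.braiding_naturality_right_assoc]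

section

variable {D : Type v} [EnrichedCategory V D] {W : EnrichedFunctor V Dᵒᵖ V}
  {S : EnrichedFunctor V D C}

lemma leftFamily_evalAt {A B : C} (y : 𝟙_ V ⟶ (natFunctor W S).obj A) {Y : V}
    (g : Y ⟶ EnrichedCategory.Hom A B) (X : Dᵒᵖ) :
    leftFamily W S (evalAt (natFunctor W S) y g) X =
      hcomp ((ρ_ _).inv ≫ leftFamily W S y X) g := by
  rw [evalAt, leftFamily_comp, leftFamily_actOn, hcomp_comp_left]
  simp

/-- The cocone corresponding to an element of `[Dᵒᵖ,V](W, C(S-,L))`. -/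
def weightHomOfPoint {L : C} (ξ : 𝟙_ V ⟶ (natFunctor W S).obj L) : WeightHom W (homTo S L) :=
  WeightHom.ofAct (fun X => (ρ_ _).inv ≫ leftFamily W S ξ X) fun X Y => by
    have h := isLeftNatFamily_leftFamily W S ξ X Y
    have h1 : hcomp (S.map Y.unop X.unop) ((ρ_ _).inv ≫ leftFamily W S ξ X) =
        leftAct W X Y ≫ (ρ_ _).inv ≫ leftFamily W S ξ Y := by
      rw [hcomp_comp_right, h]
      simp
    have h2 : ((ρ_ _).inv ≫ leftFamily W S ξ X) ▷ _ ≫ act (homTo S L) X Y =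
        (β_ (W.obj X) (EnrichedCategory.Hom Y.unop X.unop)).hom ≫
          hcomp (S.map Y.unop X.unop) ((ρ_ _).inv ≫ leftFamily W S ξ X) := by
      rw [hcomp, MonoidalCategory.tensorHom_def', Category.assoc,
        ← BraidedCategory.braiding_naturality_left_assoc,
        ← BraidedCategory.braiding_naturality_right_assoc]
      exact congrArg (fun f => ((ρ_ _).inv ≫ leftFamily W S ξ X) ▷ _ ≫ f) (act_homTo S L X Y)
    refine Eq.trans ?_ h2.symm
    rw [h1, leftAct]
    refine Eq.symm ((congrArg _ (Category.assoc _ _ _)).trans ?_)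
    exact SymmetricCategory.symmetry_assoc _ _ _

lemma colimitMap_weightHomOfPoint {L : C} (ξ : 𝟙_ V ⟶ (natFunctor W S).obj L) (A : C) :
    colimitMap (weightHomOfPoint ξ) A = evalMap (natFunctor W S) ξ A := by
  apply leftFamily_ext
  intro X
  have h : leftFamily W S (colimitMap (weightHomOfPoint ξ) A) X =
      ((ρ_ _).inv ≫ leftFamily W S ξ X) ▷ _ ≫ eComp V (S.obj X.unop) L A :=
    (congrArg MonoidalClosed.uncurry (natObjLift_π W (homTo S A) _ _ X)).trans
      (MonoidalClosed.uncurry_curry _)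
  rw [h, evalMap, leftFamily_evalAt, hcomp, MonoidalCategory.tensorHom_id]

end

/-- `F` satisfies the solution set condition. -/
def HasSolutionSet (F : EnrichedFunctor V C V) : Prop :=
  ∃ (ι : Type v) (K : ι → C) (x : ∀ i, 𝟙_ V ⟶ F.obj (K i)),
    ∀ (B : C) (y : 𝟙_ V ⟶ F.obj B), ∃ (i : ι) (u : 𝟙_ V ⟶ EnrichedCategory.Hom (K i) B),
      evalAt F (x i) u = y

/-- The general adjoint functor theorem for shrinkable weak colimits. -/
theorem hasShrinkableWeakColimits_of_hasSolutionSet [ModelCategory V] (hV : IsMonoidalModel V)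
    (hpow : HasPowers V C) (hlim : HasEnoughCofibrantlyWeightedLimits V C)
    (hsol : ∀ {D : Type v} [EnrichedCategory V D] (W : EnrichedFunctor V Dᵒᵖ V)
      (S : EnrichedFunctor V D C), HasSolutionSet (natFunctor W S)) :
    HasShrinkableWeakColimits V C := by
  intro D _ W S
  obtain ⟨ι, K, x, hK⟩ := hsol W S
  obtain ⟨L, ξ, hξ⟩ := exists_isHomotopyInitial hV.isCofibrant_unit
    (fun K x => ElementsLimit.nonempty hlim fun h => h.natFunctor W S) K x hK
  refine ⟨L, weightHomOfPoint ξ, fun A => ?_⟩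
  rw [colimitMap_weightHomOfPoint]
  exact hξ.shrinkable hpow (fun h => h.natFunctor W S) A

end
end EWeak

/-! ### Strong covers by presentable objects, and trees -/

namespace EWeak
noncomputable section

variable {V : Type u} [Category.{v} V]

/-- A family of morphisms with common target `Y` is a strong cover if a morphism out of `Y` factors
through a given monomorphism as soon as its restrictions along the family do. -/
def IsStrongCover {J : Type w} {T : J → V} {Y : V} (q : ∀ j, T j ⟶ Y) : Prop :=
  ∀ ⦃P Q : V⦄ (m : P ⟶ Q) [Mono m] (x : Y ⟶ Q),
    (∀ j, ∃ z : T j ⟶ P, z ≫ m = q j ≫ x) → ∃ z : Y ⟶ P, z ≫ m = x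

lemma IsStrongCover.hom_ext [HasEqualizers V] {J : Type w} {T : J → V} {Y : V} {q : ∀ j, T j ⟶ Y}
    (hq : IsStrongCover q) {Z : V} {f g : Y ⟶ Z} (h : ∀ j, q j ≫ f = q j ≫ g) : f = g := by
  obtain ⟨z, hz⟩ := hq (equalizer.ι f g) (𝟙 Y) fun j =>
    ⟨equalizer.lift (q j) (h j), by simp⟩
  rw [← Category.id_comp f, ← Category.id_comp g, ← hz, Category.assoc, Category.assoc,
    equalizer.condition]

/-- Factorizations through a monomorphism are unique, hence compatible, hence a cocone. -/
lemma isStrongCover_of_isColimit {J : Type w} [Category.{w} J] {F : J ⥤ V} {c : Cocone F}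
    (hc : IsColimit c) : IsStrongCover fun j => c.ι.app j := by
  intro P Q m _ x h
  choose z hz using h
  refine ⟨hc.desc ⟨P, { app := z, naturality := fun i j f => ?_ }⟩, ?_⟩
  · rw [← cancel_mono m]
    simp [hz]
  · refine hc.hom_ext fun j => ?_
    rw [hc.fac_assoc]
    exact hz j

/-- A locally presentable category has a small set of presentable objects by which every object
is covered. -/
lemma exists_presentable_cover (κ₀ κ : Cardinal.{v}) [Fact κ₀.IsRegular] [Fact κ.IsRegular]
    (hκ : κ₀ ≤ κ) [HasCardinalFilteredGenerator V κ₀] :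
    ∃ (ω : Type v) (R : ω → V), (∀ a, IsCardinalPresentable (R a) κ) ∧
      ∀ Y : V, ∃ (J : Type v) (a : J → ω) (q : ∀ j, R (a j) ⟶ Y), IsStrongCover q := by
  obtain ⟨P, _, hP⟩ := HasCardinalFilteredGenerator.exists_small_generator V κ₀
  refine ⟨Shrink.{v} (Subtype P), fun a => ((equivShrink _).symm a).1, fun a => ?_, fun Y => ?_⟩
  · have : IsCardinalPresentable ((equivShrink (Subtype P)).symm a).1 κ₀ :=
      hP.le_isCardinalPresentable _ ((equivShrink (Subtype P)).symm a).2
    exact isCardinalPresentable_of_le _ hκ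
  · obtain ⟨J, _, _, ⟨p⟩⟩ := hP.exists_colimitsOfShape Y
    refine ⟨J, fun j => equivShrink _ ⟨p.diag.obj j, p.prop_diag_obj j⟩,
      fun j => eqToHom (by simp) ≫ p.ι.app j, ?_⟩
    intro A B m _ x h
    refine isStrongCover_of_isColimit p.isColimit m x fun j => ?_
    obtain ⟨z, hz⟩ := h j
    refine ⟨eqToHom (by simp) ≫ z, ?_⟩
    rw [Category.assoc, hz]
    simp

/-- Trees generated by leaves in `T` under operations in `Θ` and formation of families indexed by
subsets of `κ`. -/
inductive Tree (T Θ : Type v) (κ : Cardinal.{v}) : Type v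
  | base (t : T) : Tree T Θ κ
  | step (θ : Θ) (m : Tree T Θ κ) : Tree T Θ κ
  | bound (s : Set κ.ord.ToType) (f : s → Tree T Θ κ) : Tree T Θ κ

namespace Tree

variable {T Θ : Type v} {κ : Cardinal.{v}} {α : Type v} [PartialOrder α] [Nonempty α]

open Classical in
/-- Interpretation of trees in a poset, given the values of the leaves and relations specifying
the values of the operations; families are sent to an upper bound. -/
def eval (b : T → α) (R : Θ → α → α → Prop) : Tree T Θ κ → α
  | base t => b t
  -- An inapplicable operation leaves the value unchanged. A family without upper bound, possible
  -- when it has κ members, gets an arbitrary value.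
  | step θ m => if h : ∃ y, R θ (eval b R m) y then h.choose else eval b R m
  | bound _ f => if h : ∃ y, ∀ x, eval b R (f x) ≤ y then h.choose else Classical.arbitrary α

variable (b : T → α) {R : Θ → α → α → Prop}

lemma rel_eval_step (θ : Θ) (m : Tree T Θ κ) (h : ∃ y, R θ (eval b R m) y) :
    R θ (eval b R m) (eval b R (step θ m)) := by
  rw [eval, dif_pos h]
  exact h.choose_spec

lemma eval_le_eval_bound {s : Set κ.ord.ToType} (f : s → Tree T Θ κ)
    (h : ∃ y, ∀ x, eval b R (f x) ≤ y) (x : s) : eval b R (f x) ≤ eval b R (bound s f) := by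
  rw [eval, dif_pos h]
  exact h.choose_spec x

/-- The preorder on trees induced by an interpretation in a poset. -/
@[reducible]
def preorder (b : T → α) (R : Θ → α → α → Prop) : Preorder (Tree T Θ κ) :=
  Preorder.lift (eval b R)

lemma isCardinalFiltered [Fact κ.IsRegular] [IsCardinalFiltered α κ] (b : T → α)
    (R : Θ → α → α → Prop) :
    @IsCardinalFiltered (Tree T Θ κ) (@Preorder.smallCategory _ (preorder b R)) κ _ := by
  let : Preorder (Tree T Θ κ) := preorder b R
  refine isCardinalFiltered_preorder _ κ fun ι f hι => ?_
  -- Fewer than κ trees can be reindexed by a subset of κ, so `bound` applies to them.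
  obtain ⟨e⟩ : Nonempty (ι ↪ κ.ord.ToType) := by
    rw [← Cardinal.le_def, Cardinal.mk_toType, Cardinal.card_ord]
    exact hι.le
  let e' := Equiv.ofInjective e e.injective
  refine ⟨bound (Set.range e) fun x => f (e'.symm x), fun i => ?_⟩
  have h : ∃ y, ∀ x, eval b R (f (e'.symm x)) ≤ y :=
    ⟨IsCardinalFiltered.max (fun i => eval b R (f i)) (by rwa [hasCardinalLT_iff_cardinal_mk_lt]),
      fun x => leOfHom (IsCardinalFiltered.toMax (fun i => eval b R (f i)) _ _)⟩
  have := eval_le_eval_bound b (fun x => f (e'.symm x)) h (e' i)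
  rwa [Equiv.symm_apply_apply] at this

end Tree

end
end EWeak

/-! ### Directed presentations by generators -/

namespace EWeak
noncomputable section

variable {V : Type u} [Category.{v} V] [MonoidalCategory V] {C : Type u'} [EnrichedCategory V C]

section
variable [SymmetricCategory V] [MonoidalClosed V]

lemma IsConicalColimit.whisker {H J : Type v} [SmallCategory H] [SmallCategory J]
    {F : H ⥤ ForgetEnrichment V C} {c : Cocone F} (hc : IsConicalColimit c) (Ψ : J ⥤ H)
    [Ψ.Final] : IsConicalColimit (c.whisker Ψ) :=
  ⟨hc.1.map fun h => (Functor.Final.isColimitWhiskerEquiv Ψ c).symm h,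
    fun X => (hc.2 X).map fun h => (Functor.Initial.isLimitWhiskerEquiv Ψ.op
      (((eHomFunctor V (ForgetEnrichment V C)).flip.obj X).mapCone c.op)).symm h⟩

lemma IsConicalColimit.precompose {H : Type v} [SmallCategory H]
    {F F' : H ⥤ ForgetEnrichment V C} {c : Cocone F} (hc : IsConicalColimit c) (e : F' ≅ F) :
    IsConicalColimit ((Cocone.precompose e.hom).obj c) := by
  refine ⟨hc.1.map fun h => (IsColimit.precomposeHomEquiv e c).symm h, fun X => ?_⟩
  let Φ := (eHomFunctor V (ForgetEnrichment V C)).flip.obj X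
  refine (hc.2 X).map fun h => ?_
  refine IsLimit.ofIsoLimit ((IsLimit.postcomposeHomEquiv
    (Functor.isoWhiskerRight (NatIso.op e) Φ) (Φ.mapCone c.op)).symm h) ?_
  exact Cone.ext (Iso.refl _) fun j => by
    simp [Φ]

/-- In an accessible category every object is a conical colimit of generators indexed by a
directed poset. -/
lemma exists_directed_presentation {κ : Cardinal.{v}} [Fact κ.IsRegular] {ι : Type v}
    {G : ι → ForgetEnrichment V C} {X : ForgetEnrichment V C}
    (hX : ∃ (H : Type v) (_ : SmallCategory H) (_ : IsCardinalFiltered H κ)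
        (F : H ⥤ ForgetEnrichment V C) (t : F ⟶ (Functor.const H).obj X),
        (∀ h, ∃ i, Nonempty (F.obj h ≅ G i)) ∧ IsConicalColimit ⟨X, t⟩) :
    ∃ (α : Type v) (_ : PartialOrder α) (_ : IsCardinalFiltered α κ)
      (F : α ⥤ InducedCategory (ForgetEnrichment V C) G)
      (t : F ⋙ inducedFunctor G ⟶ (Functor.const α).obj X), IsConicalColimit ⟨X, t⟩ := by
  obtain ⟨H, _, _, F, t, hF, ht⟩ := hX
  -- Restrict along a final functor from a κ-directed poset, then replace each value by the
  -- isomorphic generator, so that the diagram takes values strictly in the family G.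
  obtain ⟨α, _, hα, Ψ, _⟩ := IsCardinalFiltered.exists_cardinal_directed H κ
  choose i e using hF
  let e' := fun h => (e h).some
  let F' : α ⥤ InducedCategory (ForgetEnrichment V C) G :=
    { obj a := i (Ψ.obj a)
      map {a b} f := InducedCategory.homMk ((e' _).inv ≫ F.map (Ψ.map f) ≫ (e' _).hom)
      map_id a := by ext; simp
      map_comp f g := by ext; simp }
  let iso : F' ⋙ inducedFunctor G ≅ Ψ ⋙ F :=
    NatIso.ofComponents (fun a => (e' (Ψ.obj a)).symm) fun f => by
      simp [F']
  exact ⟨α, inferInstance, hα, F', _, (ht.whisker Ψ).precompose iso⟩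

end
end
end EWeak

/-! ### Diagrams indexed by trees and the monomorphisms they induce -/

namespace EWeak
noncomputable section

variable {V : Type u} [Category.{v} V] [MonoidalCategory V] [SymmetricCategory V]
  [MonoidalClosed V] {C : Type u'} [EnrichedCategory V C]

section
variable {H : Type v} [SmallCategory H] {F : H ⥤ ForgetEnrichment V C} {c : Cocone F}
  {A B : ForgetEnrichment V C} {m : B ⟶ A}

lemma IsConicalColimit.hom_ext (hc : IsConicalColimit c) {X : ForgetEnrichment V C} {Y : V}
    {f g : Y ⟶ (c.pt ⟶[V] X)}
    (h : ∀ j, f ≫ eHomWhiskerRight V (c.ι.app j) X = g ≫ eHomWhiskerRight V (c.ι.app j) X) :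
    f = g :=
  (hc.2 X).some.hom_ext fun j => h j.unop

lemma IsConicalColimit.mono_eHomWhiskerLeft (hc : IsConicalColimit c)
    (hm : ∀ j, Mono (eHomWhiskerLeft V (F.obj j) m)) : Mono (eHomWhiskerLeft V c.pt m) where
  right_cancellation f g h := hc.hom_ext fun j => by
    have := hm j
    rw [← cancel_mono (eHomWhiskerLeft V (F.obj j) m)]
    have e := eHom_whisker_exchange V (c.ι.app j) m
    have h' := congrArg (fun k => k ≫ eHomWhiskerRight V (c.ι.app j) A) h
    simp only [Category.assoc] at h' ⊢
    exact (congrArg (f ≫ ·) e).symm.trans (h'.trans (congrArg (g ≫ ·) e))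

/-- The factorizations at the stages are unique because each C(F j, m) is monic; so they are
compatible and assemble in the limit C(c.pt, B). -/
lemma IsConicalColimit.exists_factor (hc : IsConicalColimit c)
    (hm : ∀ j, Mono (eHomWhiskerLeft V (F.obj j) m)) {Y : V} (x : Y ⟶ (c.pt ⟶[V] A))
    (hx : ∀ j, ∃ z : Y ⟶ (F.obj j ⟶[V] B),
      z ≫ eHomWhiskerLeft V (F.obj j) m = x ≫ eHomWhiskerRight V (c.ι.app j) A) :
    ∃ z : Y ⟶ (c.pt ⟶[V] B), z ≫ eHomWhiskerLeft V c.pt m = x := by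
  choose z hz using hx
  have hnat (i j : H) (f : i ⟶ j) : z j ≫ eHomWhiskerRight V (F.map f) B = z i := by
    have := hm i
    rw [← cancel_mono (eHomWhiskerLeft V (F.obj i) m), hz, Category.assoc,
      ← eHom_whisker_exchange, reassoc_of% (hz j), ← eHomWhiskerRight_comp, c.w]
  let s : Cone (F.op ⋙ (eHomFunctor V (ForgetEnrichment V C)).flip.obj B) :=
    { pt := Y
      π := { app := fun j => z j.unop
             naturality := fun i j f => (Category.id_comp _).trans (hnat _ _ f.unop).symm } }
  obtain ⟨l, hl⟩ : ∃ l : Y ⟶ (c.pt ⟶[V] B), ∀ j, l ≫ eHomWhiskerRight V (c.ι.app j) B = z j :=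
    ⟨(hc.2 B).some.lift s, fun j => (hc.2 B).some.fac s (op j)⟩
  refine ⟨l, hc.hom_ext fun j => ?_⟩
  rw [← hz j, ← hl j, Category.assoc, Category.assoc]
  exact congrArg _ (eHom_whisker_exchange V (c.ι.app j) m)

end

/-- A pair of parallel morphisms from one of the `R a` to one of the `C(G g, G g')`. -/
structure HomPair {ω ι : Type v} (R : ω → V) (G : ι → ForgetEnrichment V C) : Type v where
  a : ω
  g : ι
  g' : ι
  p : R a ⟶ (G g ⟶[V] G g')
  q : R a ⟶ (G g ⟶[V] G g')

section
variable {κ : Cardinal.{v}} [Fact κ.IsRegular] {ω ι : Type v} {R : ω → V}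
  {G : ι → ForgetEnrichment V C}

/-- The relation `x ≤ y` in the index poset of a diagram, together with the condition that the
given pair of morphisms becomes equal at `y`. -/
def HomPair.EqualizedAt {α : Type v} [PartialOrder α]
    (F : α ⥤ InducedCategory (ForgetEnrichment V C) G) (θ : HomPair R G) (x y : α) : Prop :=
  -- A formal operation may be applied to any tree; where the generator at x is not the target of θ,
  -- nothing beyond x ≤ y is required.
  ∃ l : x ≤ y, ∀ e : θ.g' = F.obj x,
    θ.p ≫ eHomWhiskerLeft V (G θ.g) (eqToHom (congrArg G e) ≫ (F.map (homOfLE l)).hom) =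
      θ.q ≫ eHomWhiskerLeft V (G θ.g) (eqToHom (congrArg G e) ≫ (F.map (homOfLE l)).hom)

/-- A small `κ`-filtered diagram of generators indexed by trees. -/
structure TreeDiagram (T : Type v) (κ : Cardinal.{v}) [Fact κ.IsRegular] (R : ω → V)
    (G : ι → ForgetEnrichment V C) : Type v where
  preorder : Preorder (Tree T (HomPair R G) κ)
  isCardinalFiltered : IsCardinalFiltered (Tree T (HomPair R G) κ) κ
  functor : Tree T (HomPair R G) κ ⥤ InducedCategory (ForgetEnrichment V C) G

/-- The index category of a diagram indexed by trees. -/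
def TreeDiagram.Shape {T : Type v} (_ : TreeDiagram T κ R G) : Type v := Tree T (HomPair R G) κ

instance {T : Type v} (Δ : TreeDiagram T κ R G) : Preorder Δ.Shape := Δ.preorder

instance {T : Type v} (Δ : TreeDiagram T κ R G) : IsCardinalFiltered Δ.Shape κ :=
  Δ.isCardinalFiltered

/-- The underlying diagram of a diagram indexed by trees. -/
def TreeDiagram.diagram {T : Type v} (Δ : TreeDiagram T κ R G) :
    Δ.Shape ⥤ ForgetEnrichment V C :=
  Δ.functor ⋙ inducedFunctor G

/-- The comparison from the colimit of a diagram indexed by trees to the colimit of the directed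
diagram in which the trees are evaluated induces monomorphisms on the `C(G g, -)`. -/
lemma mono_of_tree [HasLimits V]
    (hcov : ∀ Y : V, ∃ (J : Type v) (a : J → ω) (q : ∀ j, R (a j) ⟶ Y), IsStrongCover q)
    {α : Type v} [PartialOrder α] [Nonempty α]
    {F : α ⥤ InducedCategory (ForgetEnrichment V C) G} {A B : ForgetEnrichment V C}
    {k : ∀ x, G (F.obj x) ⟶ A} (hk : ∀ {a g} {x : α} (p q : R a ⟶ (G g ⟶[V] G (F.obj x))),
      p ≫ eHomWhiskerLeft V (G g) (k x) = q ≫ eHomWhiskerLeft V (G g) (k x) →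
        ∃ (y : α) (l : x ≤ y), p ≫ eHomWhiskerLeft V (G g) (F.map (homOfLE l)).hom =
          q ≫ eHomWhiskerLeft V (G g) (F.map (homOfLE l)).hom)
    {T : Type v} (b : T → α) {ev : Tree T (HomPair R G) κ → α}
    (hev : ev = Tree.eval b (HomPair.EqualizedAt F))
    (hdir : ∀ x y, ∃ z, ev x ≤ ev z ∧ ev y ≤ ev z)
    {j : ∀ x, G (F.obj (ev x)) ⟶ B}
    (hj : ∀ {x y} (l : ev x ≤ ev y), (F.map (homOfLE l)).hom ≫ j y = j x)
    (hsurj : ∀ {a g} (f : R a ⟶ (G g ⟶[V] B)),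
      ∃ (x : _) (f₁ : R a ⟶ (G g ⟶[V] G (F.obj (ev x)))), f₁ ≫ eHomWhiskerLeft V (G g) (j x) = f)
    {m : B ⟶ A} (hm : ∀ x, j x ≫ m = k (ev x)) (g : ι) : Mono (eHomWhiskerLeft V (G g) m) := by
  -- Monicity may be tested on the R a, since they strongly cover every object.
  have key : ∀ (a : ω) (f f' : R a ⟶ (G g ⟶[V] B)),
      f ≫ eHomWhiskerLeft V (G g) m = f' ≫ eHomWhiskerLeft V (G g) m → f = f' := by
    intro a f f' h
    obtain ⟨x₁, f₁, rfl⟩ := hsurj f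
    obtain ⟨x₂, f₂, rfl⟩ := hsurj f'
    obtain ⟨x, l₁, l₂⟩ := hdir x₁ x₂
    rw [← hj l₁, ← hj l₂] at h ⊢
    simp only [eHomWhiskerLeft_comp, ← Category.assoc] at h ⊢
    generalize f₁ ≫ eHomWhiskerLeft V (G g) (F.map (homOfLE l₁)).hom = p at h ⊢
    generalize f₂ ≫ eHomWhiskerLeft V (G g) (F.map (homOfLE l₂)).hom = q at h ⊢
    simp only [Category.assoc, ← eHomWhiskerLeft_comp, hm] at h
    obtain ⟨y, l, hy⟩ := hk p q h
    -- The stage y equalizing p and q need not be the value of a tree. The operation θ supplies one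
    -- that is.
    let θ : HomPair R G := ⟨a, g, F.obj (ev x), p, q⟩
    have hθ : θ.EqualizedAt F (ev x) (ev (.step θ x)) := by
      rw [hev]
      refine Tree.rel_eval_step b θ x ⟨y, ?_⟩
      rw [← hev]
      exact ⟨l, fun _ => by simpa using hy⟩
    obtain ⟨l', h'⟩ := hθ
    have h' := h' rfl
    rw [eqToHom_refl, Category.id_comp] at h'
    rw [← hj l', eHomWhiskerLeft_comp, ← Category.assoc, ← Category.assoc]
    exact congrArg (· ≫ _) h'
  refine ⟨fun {Y} f f' h => ?_⟩
  obtain ⟨J, a, q, hq⟩ := hcov Y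
  exact hq.hom_ext fun j => key (a j) _ _ (by rw [Category.assoc, Category.assoc, h])

/-- Every `κ`-directed colimit `A` of generators receives a monomorphism from the colimit of a
diagram indexed by trees, through which a prescribed family of maps into the `C(G i, A)`
factors. -/
lemma exists_treeDiagram [HasLimits V] (hG : ∀ i, IsEnrichedPresentable V κ (G i))
    (hR : ∀ a, IsCardinalPresentable (R a) κ)
    (hcov : ∀ Y : V, ∃ (J : Type v) (a : J → ω) (q : ∀ j, R (a j) ⟶ Y), IsStrongCover q)
    {α : Type v} [PartialOrder α] [IsCardinalFiltered α κ]
    {F : α ⥤ InducedCategory (ForgetEnrichment V C) G} {c : Cocone (F ⋙ inducedFunctor G)}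
    (hc : IsConicalColimit c) {T : Type v} (a : T → ω) (i : T → ι)
    (p : ∀ t, R (a t) ⟶ (G (i t) ⟶[V] c.pt)) :
    ∃ Δ : TreeDiagram T κ R G, ∀ c' : Cocone Δ.diagram,
      IsConicalColimit c' → ∃ m : c'.pt ⟶ c.pt, (∀ i, Mono (eHomWhiskerLeft V (G i) m)) ∧
        ∀ t, ∃ z : R (a t) ⟶ (G (i t) ⟶[V] c'.pt), z ≫ eHomWhiskerLeft V (G (i t)) m = p t := by
  have := IsCardinalFiltered.nonempty α κ
  -- C(G (i t),-) preserves the directed colimit and R (a t) is presentable, so each p t factors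
  -- through a stage; these stages are the values of the leaves.
  have hp (t : T) : ∃ (x : α) (z : R (a t) ⟶ (G (i t) ⟶[V] G (F.obj x))),
      z ≫ eHomWhiskerLeft V (G (i t)) (c.ι.app x) = p t :=
    have := hR (a t)
    IsCardinalPresentable.exists_hom_of_isColimit κ (hG (i t) α _ c hc).some (p t)
  choose b z hz using hp
  let E := HomPair.EqualizedAt (R := R) F
  let Δ : TreeDiagram T κ R G := by
    letI := Tree.preorder (κ := κ) b E
    exact
      { preorder := inferInstance
        isCardinalFiltered := Tree.isCardinalFiltered b E
        functor := Monotone.functor (f := Tree.eval b E) (fun _ _ h => h) ⋙ F }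
  refine ⟨Δ, fun c' hc' => ?_⟩
  let s : Cocone Δ.diagram :=
    ⟨c.pt, { app := fun x => c.ι.app (Tree.eval b E x)
             naturality := fun x y f => c.ι.naturality (homOfLE (leOfHom f :) :) }⟩
  obtain ⟨j, hj⟩ : ∃ j : ∀ x : Tree T (HomPair R G) κ, G (F.obj (Tree.eval b E x)) ⟶ c'.pt,
      j = c'.ι.app := ⟨_, rfl⟩
  obtain ⟨m, hm⟩ : ∃ m : c'.pt ⟶ c.pt, ∀ x, j x ≫ m = c.ι.app (Tree.eval b E x) :=
    ⟨hc'.1.some.desc s, fun x => by rw [hj]; exact hc'.1.some.fac s x⟩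
  refine ⟨m, fun g => ?_, fun t => ?_⟩
  · refine mono_of_tree hcov (F := F) (k := c.ι.app) ?_ b rfl ?_ (j := j) ?_ ?_ hm g
    · intro a g x p q h
      have := hR a
      obtain ⟨y, l, hy⟩ :=
        IsCardinalPresentable.exists_eq_of_isColimit' κ (hG g α _ c hc).some p q h
      exact ⟨y, leOfHom l, hy⟩
    · intro x y
      have := isFiltered_of_isCardinalFiltered Δ.Shape κ
      obtain ⟨z, l₁, l₂, _⟩ := IsFilteredOrEmpty.cocone_objs (C := Δ.Shape) x y
      exact ⟨z, leOfHom l₁, leOfHom l₂⟩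
    · intro x y l
      rw [hj]
      have l' : @LE.le Δ.Shape _ x y := l
      exact c'.w (homOfLE l')
    · intro a g f
      have := hR a
      rw [hj]
      exact IsCardinalPresentable.exists_hom_of_isColimit κ (hG g Δ.Shape _ c' hc').some f
  · obtain ⟨z', hz'⟩ : ∃ z' : R (a t) ⟶ (G (i t) ⟶[V] G (F.obj (Tree.eval b E (.base t)))),
        z' ≫ eHomWhiskerLeft V (G (i t)) (c.ι.app (Tree.eval b E (.base t))) = p t :=
      ⟨z t, hz t⟩
    refine ⟨z' ≫ eHomWhiskerLeft V (G (i t)) (j (.base t)), ?_⟩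
    rw [Category.assoc, ← eHomWhiskerLeft_comp, hm]
    exact hz'

end

end
end EWeak

/-! ### The solution set condition -/

namespace EWeak
noncomputable section

variable {V : Type u} [Category.{v} V] [MonoidalCategory V] [SymmetricCategory V]
  [MonoidalClosed V] [HasLimits V] {C : Type u'} [EnrichedCategory V C] {D : Type v}
  [EnrichedCategory V D] {W : EnrichedFunctor V Dᵒᵖ V} {S : EnrichedFunctor V D C}

lemma hcomp_postComp {A B D E : C} (u : 𝟙_ V ⟶ EnrichedCategory.Hom D E) {X Y : V}
    (f : X ⟶ EnrichedCategory.Hom A B) (g : Y ⟶ EnrichedCategory.Hom B D) :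
    hcomp f (g ≫ postComp u B) = hcomp f g ≫ postComp u A := by
  rw [comp_postComp, comp_postComp, hcomp_comp_right, hcomp_assoc]
  simp

/-- A cocone on `A` that factors pointwise through a point of `C(B,A)` inducing monomorphisms on
the `C(S d, -)` comes from a cocone on `B`. -/
lemma exists_evalAt_eq {A B : C} (u : 𝟙_ V ⟶ EnrichedCategory.Hom B A)
    (hu : ∀ d : Dᵒᵖ, Mono (postComp u (S.obj d.unop))) (y : 𝟙_ V ⟶ (natFunctor W S).obj A)
    (hy : ∀ d : Dᵒᵖ, ∃ z : W.obj d ⊗ 𝟙_ V ⟶ EnrichedCategory.Hom (S.obj d.unop) B,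
      z ≫ postComp u (S.obj d.unop) = leftFamily W S y d) :
    ∃ x : 𝟙_ V ⟶ (natFunctor W S).obj B, evalAt (natFunctor W S) x u = y := by
  choose z hz using hy
  have hnat : IsLeftNatFamily W S z := by
    intro X Y
    have := hu Y
    rw [← cancel_mono (postComp u (S.obj Y.unop)), ← hcomp_postComp, hz, Category.assoc,
      Category.assoc, hz]
    exact isLeftNatFamily_leftFamily W S y X Y
  refine ⟨leftLift z hnat, leftFamily_ext W S fun X => ?_⟩
  have e : (ρ_ (W.obj X)).inv ▷ 𝟙_ V = (ρ_ (W.obj X ⊗ 𝟙_ V)).inv := by monoidal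
  rw [leftFamily_evalAt, leftFamily_leftLift, hcomp_comp_left, e, ← comp_postComp, hz]

lemma postComp_eq_eHomWhiskerLeft {A B : C} (m : ForgetEnrichment.of V B ⟶ ForgetEnrichment.of V A)
    (X : C) : postComp (ForgetEnrichment.homTo V m) X =
      eHomWhiskerLeft V (ForgetEnrichment.of V X) m := by
  rw [postComp, hcomp, MonoidalCategory.id_tensorHom]
  rfl

lemma exists_evalAt_homTo_eq {A B : C} (m : ForgetEnrichment.of V B ⟶ ForgetEnrichment.of V A)
    (hm : ∀ d : Dᵒᵖ, Mono (eHomWhiskerLeft V (ForgetEnrichment.of V (S.obj d.unop)) m))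
    (y : 𝟙_ V ⟶ (natFunctor W S).obj A)
    (hy : ∀ d : Dᵒᵖ, ∃ z : W.obj d ⊗ 𝟙_ V ⟶
        (ForgetEnrichment.of V (S.obj d.unop) ⟶[V] ForgetEnrichment.of V B),
      z ≫ eHomWhiskerLeft V (ForgetEnrichment.of V (S.obj d.unop)) m = leftFamily W S y d) :
    ∃ x : 𝟙_ V ⟶ (natFunctor W S).obj B,
      evalAt (natFunctor W S) x (ForgetEnrichment.homTo V m) = y :=
  exists_evalAt_eq (ForgetEnrichment.homTo V m)
    (fun d => by rw [postComp_eq_eHomWhiskerLeft]; exact hm d) y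
    (fun d => by rw [postComp_eq_eHomWhiskerLeft]; exact hy d)

/-- The solution set consists of all points of F at the colimits of all tree diagrams, a small
collection because leaves, operations and values of the diagrams range over small types. -/
lemma hasSolutionSet_natFunctor (hacc : IsEnrichedAccessible V C) (W : EnrichedFunctor V Dᵒᵖ V)
    (S : EnrichedFunctor V D C) : HasSolutionSet (natFunctor W S) := by
  obtain ⟨κ₀, κ, _, _, hV, hle, hC⟩ := hacc
  have := hV.isCardinalLocallyPresentable
  obtain ⟨ω, R, hR, hcov⟩ := exists_presentable_cover (V := V) κ₀ κ hle
  obtain ⟨ι, G, hG, hpres⟩ := hC.exists_generator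
  have hdir (X : ForgetEnrichment V C) := exists_directed_presentation (hpres X)
  choose α _ _ F t ht using fun d : Dᵒᵖ => hdir (ForgetEnrichment.of V (S.obj d.unop))
  choose J a q hq using fun d : Dᵒᵖ => hcov (W.obj d ⊗ 𝟙_ V)
  -- The leaves are fixed by W and S alone, independently of A: a stage in a presentation of S d and
  -- a member of a cover of W d ⊗ I.
  let T := Σ d : Dᵒᵖ, α d × J d
  choose c hc using fun Δ : TreeDiagram T κ R G => hC.exists_colimit Δ.Shape Δ.diagram
  refine ⟨Σ Δ : TreeDiagram T κ R G, (𝟙_ V ⟶ (natFunctor W S).obj (c Δ).pt),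
    fun i => (c i.1).pt, fun i => i.2, fun A y => ?_⟩
  obtain ⟨β, _, _, F', t', ht'⟩ := hdir A
  obtain ⟨Δ, hΔ⟩ := exists_treeDiagram hG hR hcov ht' (T := T) (fun s => a s.1 s.2.2)
    (fun s => (F s.1).obj s.2.1) fun s =>
      q s.1 s.2.2 ≫ leftFamily W S y s.1 ≫ eHomWhiskerRight V ((t s.1).app s.2.1) A
  obtain ⟨m, hm, hz⟩ := hΔ (c Δ) (hc Δ)
  obtain ⟨x, hx⟩ := exists_evalAt_homTo_eq m
    (fun d => (ht d).mono_eHomWhiskerLeft (m := m) fun j => hm _) y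
    -- Lifts on the pieces R a first give one on W d ⊗ I at each generator in the presentation of S
    -- d, by the cover; these then glue to a lift into C(S d, B).
    fun d => (ht d).exists_factor (m := m) (fun j => hm _) (leftFamily W S y d) fun j =>
      have := hm ((F d).obj j)
      hq d (eHomWhiskerLeft V (G ((F d).obj j)) m) _ fun k => hz ⟨d, j, k⟩
  exact ⟨⟨Δ, x⟩, ForgetEnrichment.homTo V m, hx⟩

end
end EWeak

theorem mainTheorem2 (V : Type u) [Category.{v} V] [MonoidalCategory V] [SymmetricCategory V]
    [MonoidalClosed V] [HasLimits V] [HasColimits V] [IsLocallyPresentable.{v} V]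
    [ModelCategory V] (hV : EWeak.IsMonoidalModel V)
    (C : Type u') [EnrichedCategory V C] (hacc : EWeak.IsEnrichedAccessible V C)
    (hpow : EWeak.HasPowers V C) (hlim : EWeak.HasEnoughCofibrantlyWeightedLimits V C) :
    EWeak.HasShrinkableWeakColimits V C := by
  exact EWeak.hasShrinkableWeakColimits_of_hasSolutionSet hV hpow hlim
    fun W S => EWeak.hasSolutionSet_natFunctor hacc W S
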